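/- Let $\mathbb K=\mathbb R$ or $\mathbb C$, let $H$ be an $n$-dimensional Hilbert space over $\mathbb K$ with a fixed orthonormal basis, and for $1\le p\le\infty$ let $\|x\|_p$ be the $\ell^p$ norm of the coordinates of $x\in H$ in that basis. Let $\hat H=H/\!\sim$, where $x\sim y$ iff $y=ax$ for some $a\in\mathbb K$ with $|a|=1$. On $\hat H$ put $$D_p(x,y)=\min_{|a|=1}\|x-ay\|_p,\qquad d_p(x,y)=\|xx^*-yy^*\|_p,$$ where in the second formula $\|\cdot\|_p$ is the Schatten norm (the $\ell^p$ norm of the singular values). Let $\{f_1,\dots,f_m\}$ be a frame (spanning set) of $H$ that is phase retrievable, i.e. the map $\alpha:\hat H\to\mathbb R^m$, $\alpha(x)=(|\langle x,f_k\rangle|)_{k=1}^m$, is injective; let $\beta(x)=(|\langle x,f_k\rangle|^2)_{k=1}^m$, and $$A_0=\inf_{x\ne y\in\hat H}\frac{\|\alpha(x)-\alpha(y)\|_2^2}{D_2(x,y)^2},\qquad a_0=\inf_{x\neq y\in\hat H}\frac{\|\beta(x)-\beta(y)\|_2^2}{d_1(x,y)^2}.$$ If $n\ge1$ these constants are positive.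 (If $n=0$, read $1/\sqrt{A_0}=1/\sqrt{a_0}=0$ below.) Moreover: 1. There is a map $\omega:\mathbb R^m\to\hat H$ with $\omega(\alpha(x))=x$ for all $x\in\hat H$ such that, for all $1\le p,q\le\infty$ and all $c,d\in\mathbb R^m$, $$D_q(\omega(c),\omega(d))\le\frac{3\sqrt2+4}{\sqrt{A_0}}\,n^{\frac1q-\frac12}\max\bigl(1,m^{\frac12-\frac1p}\bigr)\|c-d\|_p\quad\text{if } q\le2,$$ $$D_q(\omega(c),\omega(d))\le\frac{3\sqrt2+2^{\frac32+\frac1q}}{\sqrt{A_0}}\,n^{\frac12-\frac1q}\max\bigl(1,m^{\frac12-\frac1p}\bigr)\|c-d\|_p\quad\text{if } q>2.$$ In particular $D_2(\omega(c),\omega(d))\le\frac{4+3\sqrt2}{\sqrt{A_0}}\|c-d\|_2$. 2. There is a map $\psi:\mathbb R^m\to\hat H$ with $\psi(\beta(x))=x$ for all $x\in\hat H$ such that, for all $1\le p,q\le\infty$ and all $c,d\in\mathbb R^m$, $$d_q(\psi(c),\psi(d))\le\frac{3+2\sqrt2}{\sqrt{a_0}}\,2^{\frac1q-\frac12}\max\bigl(1,m^{\frac12-\frac1p}\bigr)\|c-d\|_p\quad\text{if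 } q\le2,$$ $$d_q(\psi(c),\psi(d))\le\frac{3+2^{1+\frac1q}}{\sqrt{a_0}}\max\bigl(1,m^{\frac12-\frac1p}\bigr)\|c-d\|_p\quad\text{if } q>2.$$ In particular $d_1(\psi(c),\psi(d))\le\frac{4+3\sqrt2}{\sqrt{a_0}}\|c-d\|_2$. Here $1/\infty=0$. -/

import Mathlib

open scoped ENNReal

noncomputable section

namespace PhaseRetrieval

variable (𝕜 : Type*) {H : Type*} [RCLike 𝕜] [NormedAddCommGroup H] [InnerProductSpace 𝕜 H]

/-- Two vectors are equivalent when they differ by a scalar of magnitude one. -/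
def phaseSetoid (H : Type*) [NormedAddCommGroup H] [InnerProductSpace 𝕜 H] : Setoid H where
  r x y := ∃ a : 𝕜, ‖a‖ = 1 ∧ y = a • x
  iseqv :=
    { refl := fun x => ⟨1, by simp, by simp⟩
      symm := by
        rintro x y ⟨a, ha, rfl⟩
        have h0 : a ≠ 0 := by
          rintro rfl
          simp at ha
        exact ⟨a⁻¹, by simp [ha], by rw [smul_smul, inv_mul_cancel₀ h0, one_smul]⟩
      trans := by
        rintro x y z ⟨a, ha, rfl⟩ ⟨b, hb, rfl⟩
        exact ⟨b * a, by simp [ha, hb], by rw [smul_smul]⟩ }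

/-- The quotient `Ĥ = H / ∼` of `H` by the scalars of magnitude one. -/
def PhaseQuotient (H : Type*) [NormedAddCommGroup H] [InnerProductSpace 𝕜 H] : Type _ :=
  Quotient (phaseSetoid 𝕜 H)

variable {𝕜}

/-- The map `α(x) = (|⟨x, f_k⟩|)_k` on `Ĥ`. -/
def alpha {m : ℕ} (f : Fin m → H) : PhaseQuotient 𝕜 H → (Fin m → ℝ) :=
  Quotient.lift (s := phaseSetoid 𝕜 H) (fun x k => ‖inner 𝕜 (f k) x‖) (by
    rintro x y ⟨a, ha, rfl⟩
    funext k
    simp [inner_smul_right, ha])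

/-- The map `β(x) = (|⟨x, f_k⟩|²)_k` on `Ĥ`. -/
def beta {m : ℕ} (f : Fin m → H) : PhaseQuotient 𝕜 H → (Fin m → ℝ) :=
  Quotient.lift (s := phaseSetoid 𝕜 H) (fun x k => ‖inner 𝕜 (f k) x‖ ^ 2) (by
    rintro x y ⟨a, ha, rfl⟩
    funext k
    simp [inner_smul_right, ha])

variable (𝕜) in
/-- A frame (spanning family) that is phase retrievable: `α` is injective on `Ĥ`. -/
structure IsPhaseRetrievableFrame {m : ℕ} (f : Fin m → H) : Prop where
  span_eq_top : Submodule.span 𝕜 (Set.range f) = ⊤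
  injective_alpha : Function.Injective (alpha (𝕜 := 𝕜) f)

/-- The `ℓ^p` norm on `ℝ^m` or on `𝕜^n`. -/
def lpNorm {E : Type*} [NormedAddCommGroup E] {m : ℕ} (p : ℝ≥0∞) (c : Fin m → E) : ℝ :=
  ‖WithLp.toLp p c‖

/-- The natural metric `D_p(x̂, ŷ) = min_{|a| = 1} ‖x - a y‖_p` on `Ĥ`, where `‖·‖_p` is the `ℓ^p`
norm of the coordinates in the orthonormal basis `b`. -/
def natDist {n : ℕ} (b : OrthonormalBasis (Fin n) 𝕜 H) (p : ℝ≥0∞) :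
    PhaseQuotient 𝕜 H → PhaseQuotient 𝕜 H → ℝ :=
  Quotient.lift₂ (s₁ := phaseSetoid 𝕜 H) (s₂ := phaseSetoid 𝕜 H)
    (fun x y => sInf {r : ℝ | ∃ a : 𝕜, ‖a‖ = 1 ∧ r = lpNorm p (fun i => b.repr (x - a • y) i)}) (by
      rintro x y _ _ ⟨s, hs, rfl⟩ ⟨t, ht, rfl⟩
      have hs0 : s ≠ 0 := by
        rintro rfl
        simp at hs
      have ht0 : t ≠ 0 := by
        rintro rfl
        simp at ht
      have key : ∀ (c : 𝕜) (z : H), ‖c‖ = 1 →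
          lpNorm p (fun i => b.repr (c • z) i) = lpNorm p (fun i => b.repr z i) := by
        intro c z hc
        unfold lpNorm
        rcases p.trichotomy with rfl | rfl | hp
        · have hc0 : c ≠ 0 := by
            rintro rfl
            simp at hc
          simp [PiLp.norm_eq_card, hc0]
        · simp [PiLp.norm_eq_ciSup, hc]
        · simp [PiLp.norm_eq_sum hp, hc]
      congr 1
      ext r
      constructor
      · rintro ⟨a, ha, rfl⟩
        refine ⟨s * a * t⁻¹, by simp [hs, ha, ht], ?_⟩
        rw [← key s _ hs, smul_sub, smul_smul, smul_smul, mul_assoc, mul_assoc,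
          inv_mul_cancel₀ ht0, mul_one]
      · rintro ⟨a, ha, rfl⟩
        refine ⟨s⁻¹ * a * t, by simp [hs, ha, ht], ?_⟩
        rw [← key s (x - _) hs, smul_sub, smul_smul, smul_smul, mul_assoc, mul_inv_cancel_left₀ hs0])

/-- The operator `x x^* : z ↦ ⟨z, x⟩ x`. -/
def outer (x : H) : H →ₗ[𝕜] H := (InnerProductSpace.rankOne 𝕜 x x).toLinearMap

/-- The Schatten `p`-norm: the `ℓ^p` norm of the singular values (`p = ∞`: the largest one). -/
def schattenNorm [FiniteDimensional 𝕜 H] (p : ℝ≥0∞) (T : H →ₗ[𝕜] H) : ℝ :=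
  lpNorm p (fun i : Fin (Module.finrank 𝕜 H) => T.singularValues i)

/-- The matrix-norm induced metric `d_p(x̂, ŷ) = ‖x x^* - y y^*‖_p` on `Ĥ`. -/
def matDist [FiniteDimensional 𝕜 H] (p : ℝ≥0∞) : PhaseQuotient 𝕜 H → PhaseQuotient 𝕜 H → ℝ :=
  Quotient.lift₂ (s₁ := phaseSetoid 𝕜 H) (s₂ := phaseSetoid 𝕜 H)
    (fun x y => schattenNorm p (outer (𝕜 := 𝕜) x - outer (𝕜 := 𝕜) y)) (by
      have key : ∀ (c : 𝕜) (z : H), ‖c‖ = 1 → outer (𝕜 := 𝕜) (c • z) = outer (𝕜 := 𝕜) z := by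
        intro c z hc
        ext w
        have h : (starRingEnd 𝕜) c * c = 1 := by
          rw [RCLike.conj_mul, hc]
          simp
        simp only [outer, ContinuousLinearMap.coe_coe, InnerProductSpace.rankOne_apply,
          inner_smul_left, smul_smul]
        rw [mul_right_comm, h, one_mul]
      rintro x y _ _ ⟨s, hs, rfl⟩ ⟨t, ht, rfl⟩
      simp only [key s x hs, key t y ht])

/-- The global lower Lipschitz bound of `α`:
`A₀ = inf_{x ≠ y} ‖α(x) - α(y)‖₂² / D₂(x, y)²`. -/
def lowerBoundAlpha {m n : ℕ} (b : OrthonormalBasis (Fin n) 𝕜 H) (f : Fin m → H) : ℝ :=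
  sInf {r : ℝ | ∃ x y : PhaseQuotient 𝕜 H, x ≠ y ∧
    r = lpNorm 2 (alpha f x - alpha f y) ^ 2 / natDist b 2 x y ^ 2}

variable (𝕜) in
/-- The global lower Lipschitz bound of `β`:
`a₀ = inf_{x ≠ y} ‖β(x) - β(y)‖₂² / d₁(x, y)²`. -/
def lowerBoundBeta [FiniteDimensional 𝕜 H] {m : ℕ} (f : Fin m → H) : ℝ :=
  sInf {r : ℝ | ∃ x y : PhaseQuotient 𝕜 H, x ≠ y ∧
    r = lpNorm 2 (beta f x - beta f y) ^ 2 / matDist 1 x y ^ 2}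

end PhaseRetrieval

end

/-!
Both left inverses are built in the real Hilbert space `E` of matrices with the Frobenius inner
product, in which `K x` stands for `xx^*` and `⟨K x, K y⟩ = |⟨x, y⟩|²` (`IsFrobeniusLift`). Since
`xx^* - yy^*` has rank at most two, `d_2` is the distance of `K x` and `K y` in `E` and controls every
`d_q`. For `D_2` the lift `K x / ‖x‖` (`rootLift`) is used instead: with `r, s` the norms and
`c` the cosine of the angle,
`D_2² = r² + s² - 2 r s c` and `‖rootLift K x - rootLift K y‖² = r² + s² - 2 r s c²`, so the two
distances agree up to a factor `√2`. Both lifts have the same range, the cone of the matrices `xx^*`.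

On the image of `α` (or `β`) the lift of the original class is a Lipschitz function of the
measurements, by the definition of the lower bounds. Kirszbraun's theorem
(`exists_lipschitz_extension`) extends it to all of `ℝ^m` with the same constant, and a retraction
of `E` onto the cone with Lipschitz constant `√5` (`exists_retraction`) brings the values back to the
cone. Because `√5 ≤ 3`, all the stated constants follow from this single Frobenius norm estimate,
combined with the comparison of `ℓ^p` norms and of Schatten norms of rank two matrices.

Kirszbraun's theorem reduces, by Zorn's lemma and compactness of balls, to finitely many points,
where Sion's minimax theorem applied to the weighted sums of `‖z - y i‖² - (L ‖x₀ - x i‖)²` gives the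
new value. The retraction sends a matrix to `(λ₁ - λ₂) uu^*`, with `u` a top eigenvector of its
symmetric part and `λ₁ ≥ λ₂` the two largest eigenvalues. If `v` and `μ₁, μ₂` belong to `B`, then
maximality of `u` and `v` gives
`(λ₁ - λ₂ + μ₁ - μ₂) (1 - |⟨u, v⟩|²) ≤ ⟨A - B, K u - K v⟩`, which with
`|λ_i - μ_i| ≤ ‖A - B‖` yields the constant `√5` (`IsTopPair.norm_sub_le`).

The lower bounds are positive because the differences of the intensities of `x` and `y` are the
numbers `re (⟨z, f k⟩ ⟨f k, w⟩)` with `z = x + y` and `w = x - y`. For representatives with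
`⟨x, y⟩ ≥ 0` these satisfy a bound from below by a multiple of `‖z‖ ‖w‖`, by compactness and
injectivity (`IsPhaseRetrievableFrame.exists_le_sum_re_sq`), while `d_1 ≤ √2 ‖z‖ ‖w‖`,
`D_2 = ‖w‖` and `‖z‖² ≥ ‖x‖² + ‖y‖²`.
-/

namespace PhaseRetrieval

/-! ### Comparison of `ℓ^p` norms -/

section LpNorm

variable {E : Type*} [NormedAddCommGroup E] {m : ℕ}

theorem lpNorm_top (c : Fin m → E) : lpNorm ∞ c = ⨆ i, ‖c i‖ := by
  simp [lpNorm, PiLp.norm_eq_ciSup]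

theorem lpNorm_eq_sum {p : ℝ≥0∞} (h1 : 1 ≤ p) (hp : p ≠ ∞) (c : Fin m → E) :
    lpNorm p c = (∑ i, ‖c i‖ ^ p.toReal) ^ (1 / p.toReal) := by
  have : 0 < p.toReal := ENNReal.toReal_pos (by positivity) hp
  simp [lpNorm, PiLp.norm_eq_sum this]

theorem lpNorm_nonneg {p : ℝ≥0∞} (h1 : 1 ≤ p) (c : Fin m → E) : 0 ≤ lpNorm p c := by
  have : Fact (1 ≤ p) := ⟨h1⟩
  exact norm_nonneg _

theorem norm_apply_le_lpNorm {p : ℝ≥0∞} (h1 : 1 ≤ p) (c : Fin m → E) (i : Fin m) :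
    ‖c i‖ ≤ lpNorm p c := by
  have : Fact (1 ≤ p) := ⟨h1⟩
  exact PiLp.norm_apply_le (WithLp.toLp p c) i

theorem lpNorm_two_sq (c : Fin m → E) : lpNorm 2 c ^ 2 = ∑ i, ‖c i‖ ^ 2 :=
  PiLp.norm_sq_eq_of_L2 _ _

theorem lpNorm_rpow {p : ℝ≥0∞} (h1 : 1 ≤ p) (hp : p ≠ ∞) (c : Fin m → E) :
    lpNorm p c ^ p.toReal = ∑ i, ‖c i‖ ^ p.toReal := by
  have hp0 : 0 < p.toReal := ENNReal.toReal_pos (by positivity) hp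
  rw [lpNorm_eq_sum h1 hp, ← Real.rpow_mul (by positivity), one_div_mul_cancel hp0.ne',
    Real.rpow_one]

/-- The `ℓ^p` norms decrease in `p`. -/
theorem lpNorm_le_lpNorm {p q : ℝ≥0∞} (h1 : 1 ≤ p) (hpq : p ≤ q) (c : Fin m → E) :
    lpNorm q c ≤ lpNorm p c := by
  have hM := lpNorm_nonneg h1 c
  rcases eq_or_ne q ∞ with rfl | hq
  · rw [lpNorm_top]
    exact Real.iSup_le (norm_apply_le_lpNorm h1 c) hM
  have hp : p ≠ ∞ := ne_top_of_le_ne_top hq hpq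
  have hp0 : 0 < p.toReal := ENNReal.toReal_pos (by positivity) hp
  have hpq' : p.toReal ≤ q.toReal := ENNReal.toReal_mono hq hpq
  have hq0 : 0 < q.toReal := hp0.trans_le hpq'
  rw [← Real.rpow_le_rpow_iff (lpNorm_nonneg (h1.trans hpq) c) hM hq0,
    lpNorm_rpow (h1.trans hpq) hq]
  calc ∑ i, ‖c i‖ ^ q.toReal
      ≤ ∑ i, ‖c i‖ ^ p.toReal * lpNorm p c ^ (q.toReal - p.toReal) := by
        refine Finset.sum_le_sum fun i _ => ?_
        rcases (norm_nonneg (c i)).eq_or_lt with h0 | h0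
        · rw [← h0, Real.zero_rpow hq0.ne', Real.zero_rpow hp0.ne', zero_mul]
        · calc ‖c i‖ ^ q.toReal = ‖c i‖ ^ p.toReal * ‖c i‖ ^ (q.toReal - p.toReal) := by
                rw [← Real.rpow_add h0, add_sub_cancel]
            _ ≤ _ := by
                gcongr
                exact norm_apply_le_lpNorm h1 c i
    _ = lpNorm p c ^ q.toReal := by
        rw [← Finset.sum_mul, ← lpNorm_rpow h1 hp]
        rcases hM.eq_or_lt with h0 | h0
        · rw [← h0, Real.zero_rpow hq0.ne', Real.zero_rpow hp0.ne', zero_mul]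
        · rw [← Real.rpow_add h0, add_sub_cancel]

/-- The reverse of `lpNorm_le_lpNorm` for vectors supported on `s`, by Hölder's inequality. -/
theorem lpNorm_le_card_rpow_mul {p q : ℝ≥0∞} (h1 : 1 ≤ p) (hpq : p ≤ q) (c : Fin m → E)
    (s : Finset (Fin m)) (hs : ∀ i ∉ s, c i = 0) :
    lpNorm p c ≤ (s.card : ℝ) ^ (1 / p.toReal - 1 / q.toReal) * lpNorm q c := by
  have hM := lpNorm_nonneg (h1.trans hpq) c
  rcases eq_or_ne p ∞ with rfl | hp
  · obtain rfl : q = ∞ := top_le_iff.1 hpq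
    simp
  have hp0 : 0 < p.toReal := ENNReal.toReal_pos (by positivity) hp
  have hsum : ∀ r : ℝ, 0 < r → ∑ i, ‖c i‖ ^ r = ∑ i ∈ s, ‖c i‖ ^ r := by
    intro r hr
    refine (Finset.sum_subset (Finset.subset_univ s) fun i _ hi => ?_).symm
    rw [hs i hi, norm_zero, Real.zero_rpow hr.ne']
  rcases eq_or_ne q ∞ with rfl | hq
  · rw [← Real.rpow_le_rpow_iff (lpNorm_nonneg h1 c) (by positivity) hp0, lpNorm_rpow h1 hp,
      hsum _ hp0, Real.mul_rpow (by positivity) hM, ← Real.rpow_mul (by positivity)]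
    have : (1 / p.toReal - 1 / (∞ : ℝ≥0∞).toReal) * p.toReal = 1 := by
      simp [hp0.ne']
    rw [this, Real.rpow_one, ← nsmul_eq_mul]
    refine Finset.sum_le_card_nsmul _ _ _ fun i _ => ?_
    gcongr
    exact norm_apply_le_lpNorm (by simp) c i
  have hpq' : p.toReal ≤ q.toReal := ENNReal.toReal_mono hq hpq
  have hq0 : 0 < q.toReal := hp0.trans_le hpq'
  rw [← Real.rpow_le_rpow_iff (lpNorm_nonneg h1 c) (by positivity) hq0,
    Real.mul_rpow (by positivity) hM, lpNorm_rpow (h1.trans hpq) hq, hsum _ hq0,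
    ← Real.rpow_mul (by positivity)]
  have h := Real.rpow_sum_le_const_mul_sum_rpow_of_nonneg (s := s)
    (f := fun i => ‖c i‖ ^ p.toReal) (p := q.toReal / p.toReal) ((one_le_div hp0).2 hpq')
    (fun i _ => by positivity)
  rw [← hsum _ hp0, ← lpNorm_rpow h1 hp, ← Real.rpow_mul (lpNorm_nonneg h1 c),
    mul_div_cancel₀ _ hp0.ne'] at h
  refine h.trans_eq ?_
  congr 1
  · congr 1
    field_simp
  · refine Finset.sum_congr rfl fun i _ => ?_
    rw [← Real.rpow_mul (norm_nonneg _), mul_div_cancel₀ _ hp0.ne']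

theorem lpNorm_le_dim_rpow_mul {p q : ℝ≥0∞} (h1 : 1 ≤ p) (hpq : p ≤ q) (c : Fin m → E) :
    lpNorm p c ≤ (m : ℝ) ^ (1 / p.toReal - 1 / q.toReal) * lpNorm q c := by
  simpa using lpNorm_le_card_rpow_mul h1 hpq c Finset.univ (by simp)

theorem lpNorm_two_le {p : ℝ≥0∞} (h1 : 1 ≤ p) (c : Fin m → E) :
    lpNorm 2 c ≤ max 1 ((m : ℝ) ^ (1 / 2 - 1 / p.toReal)) * lpNorm p c := by
  have h := lpNorm_nonneg h1 c
  rcases le_total p 2 with hp | hp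
  · exact (lpNorm_le_lpNorm h1 hp c).trans (le_mul_of_one_le_left h (le_max_left _ _))
  · refine (lpNorm_le_dim_rpow_mul one_le_two hp c).trans ?_
    gcongr
    exact le_max_right _ _

end LpNorm

/-! ### The two metrics on `Ĥ` -/

section Distances

variable {𝕜 H : Type*} [RCLike 𝕜] [NormedAddCommGroup H] [InnerProductSpace 𝕜 H]

/-- The class of a vector in `Ĥ`. -/
def phaseClass (𝕜 : Type*) {H : Type*} [RCLike 𝕜] [NormedAddCommGroup H] [InnerProductSpace 𝕜 H]
    (x : H) : PhaseQuotient 𝕜 H :=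
  Quotient.mk (phaseSetoid 𝕜 H) x

theorem exists_phaseClass (X : PhaseQuotient 𝕜 H) : ∃ x, phaseClass 𝕜 x = X :=
  Quotient.exists_rep X

theorem phaseClass_eq_iff {x y : H} :
    phaseClass 𝕜 x = phaseClass 𝕜 y ↔ ∃ a : 𝕜, ‖a‖ = 1 ∧ y = a • x :=
  Quotient.eq (r := phaseSetoid 𝕜 H)

/-- Two classes have representatives whose inner product is a nonnegative real. -/
theorem exists_aligned (X Y : PhaseQuotient 𝕜 H) :
    ∃ x y : H, phaseClass 𝕜 x = X ∧ phaseClass 𝕜 y = Y ∧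
      inner 𝕜 x y = (‖inner 𝕜 x y‖ : 𝕜) := by
  obtain ⟨x, rfl⟩ := exists_phaseClass X
  obtain ⟨y, rfl⟩ := exists_phaseClass Y
  obtain ⟨c, hc, h⟩ := RCLike.exists_norm_eq_mul_self (inner 𝕜 x y)
  refine ⟨x, c • y, rfl, (phaseClass_eq_iff.2 ⟨c, hc, rfl⟩).symm, ?_⟩
  rw [inner_smul_right, norm_mul, hc, one_mul, h]

theorem alpha_phaseClass {m : ℕ} (f : Fin m → H) (x : H) (k : Fin m) :
    alpha f (phaseClass 𝕜 x) k = ‖inner 𝕜 (f k) x‖ := rfl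

theorem beta_phaseClass {m : ℕ} (f : Fin m → H) (x : H) (k : Fin m) :
    beta f (phaseClass 𝕜 x) k = ‖inner 𝕜 (f k) x‖ ^ 2 := rfl

section NatDist

variable {n : ℕ} (b : OrthonormalBasis (Fin n) 𝕜 H)

theorem natDist_phaseClass (q : ℝ≥0∞) (x y : H) :
    natDist b q (phaseClass 𝕜 x) (phaseClass 𝕜 y) =
      sInf {r : ℝ | ∃ a : 𝕜, ‖a‖ = 1 ∧ r = lpNorm q (fun i => b.repr (x - a • y) i)} := rfl

theorem lpNorm_two_repr (x : H) : lpNorm 2 (fun i => b.repr x i) = ‖x‖ :=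
  b.repr.norm_map x

theorem natDist_le {q : ℝ≥0∞} (h1 : 1 ≤ q) (x y : H) {a : 𝕜} (ha : ‖a‖ = 1) :
    natDist b q (phaseClass 𝕜 x) (phaseClass 𝕜 y) ≤ lpNorm q (fun i => b.repr (x - a • y) i) := by
  rw [natDist_phaseClass]
  refine csInf_le ⟨0, ?_⟩ ⟨a, ha, rfl⟩
  rintro _ ⟨a, -, rfl⟩
  exact lpNorm_nonneg h1 _

theorem natDist_nonneg {q : ℝ≥0∞} (h1 : 1 ≤ q) (X Y : PhaseQuotient 𝕜 H) :
    0 ≤ natDist b q X Y := by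
  obtain ⟨x, rfl⟩ := exists_phaseClass X
  obtain ⟨y, rfl⟩ := exists_phaseClass Y
  rw [natDist_phaseClass]
  refine Real.sInf_nonneg ?_
  rintro _ ⟨a, -, rfl⟩
  exact lpNorm_nonneg h1 _

theorem natDist_two_aligned {x y : H} (h : inner 𝕜 x y = (‖inner 𝕜 x y‖ : 𝕜)) :
    natDist b 2 (phaseClass 𝕜 x) (phaseClass 𝕜 y) = ‖x - y‖ := by
  refine le_antisymm ?_ ?_
  · have := natDist_le b one_le_two x y (a := (1 : 𝕜)) (by simp)
    rwa [lpNorm_two_repr, one_smul] at this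
  · rw [natDist_phaseClass]
    refine le_csInf ⟨_, 1, by simp, rfl⟩ ?_
    rintro _ ⟨a, ha, rfl⟩
    rw [lpNorm_two_repr]
    refine le_of_sq_le_sq ?_ (norm_nonneg _)
    rw [norm_sub_sq (𝕜 := 𝕜), norm_sub_sq (𝕜 := 𝕜), inner_smul_right, norm_smul, ha, one_mul]
    have h1 : RCLike.re (a * inner 𝕜 x y) ≤ ‖inner 𝕜 x y‖ := by
      simpa [ha] using RCLike.re_le_norm (a * inner 𝕜 x y)
    have h2 : RCLike.re (inner 𝕜 x y) = ‖inner 𝕜 x y‖ := by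
      conv_lhs => rw [h]
      simp
    linarith

theorem natDist_le_mul {q : ℝ≥0∞} (h1 : 1 ≤ q) {C : ℝ}
    (hC : ∀ c : Fin n → 𝕜, lpNorm q c ≤ C * lpNorm 2 c) (X Y : PhaseQuotient 𝕜 H) :
    natDist b q X Y ≤ C * natDist b 2 X Y := by
  obtain ⟨x, y, rfl, rfl, h⟩ := exists_aligned X Y
  rw [natDist_two_aligned b h, ← lpNorm_two_repr b]
  have := natDist_le b h1 x y (a := (1 : 𝕜)) (by simp)
  rw [one_smul] at this
  exact this.trans (hC _)

theorem natDist_le_rpow_mul_of_le_two {q : ℝ≥0∞} (h1 : 1 ≤ q)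
    (hq : q ≤ 2) (X Y : PhaseQuotient 𝕜 H) :
    natDist b q X Y ≤ (n : ℝ) ^ (1 / q.toReal - 1 / 2) * natDist b 2 X Y :=
  natDist_le_mul b h1 (fun c => lpNorm_le_dim_rpow_mul h1 hq c) X Y

theorem natDist_le_rpow_mul_of_two_le {q : ℝ≥0∞} (hq : 2 ≤ q)
    (X Y : PhaseQuotient 𝕜 H) :
    natDist b q X Y ≤ (n : ℝ) ^ (1 / 2 - 1 / q.toReal) * natDist b 2 X Y := by
  refine natDist_le_mul b (one_le_two.trans hq) (fun c => ?_) X Y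
  refine (lpNorm_le_lpNorm one_le_two hq c).trans ?_
  rcases Nat.eq_zero_or_pos n with rfl | hn
  · have : lpNorm 2 c = 0 := by simp [← sq_eq_zero_iff, lpNorm_two_sq]
    simp [this]
  · refine le_mul_of_one_le_left (lpNorm_nonneg one_le_two c) ?_
    refine Real.one_le_rpow (by exact_mod_cast hn) (sub_nonneg.2 ?_)
    rw [one_div, one_div, ← ENNReal.toReal_inv]
    simpa using ENNReal.toReal_mono (by simp) (ENNReal.inv_le_inv.2 hq)

end NatDist

section MatDist

theorem outer_apply (x z : H) : outer (𝕜 := 𝕜) x z = inner 𝕜 x z • x := rfl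

theorem isSymmetric_outer (x : H) : (outer (𝕜 := 𝕜) x).IsSymmetric := by
  intro z w
  simp only [outer_apply, inner_smul_left, inner_smul_right, inner_conj_symm]
  ring

theorem finrank_range_outer_sub_le (x y : H) :
    Module.finrank 𝕜 (LinearMap.range (outer (𝕜 := 𝕜) x - outer y)) ≤ 2 := by
  classical
  have h : LinearMap.range (outer (𝕜 := 𝕜) x - outer y) ≤ Submodule.span 𝕜 ↑({x, y} : Finset H) := by
    rintro _ ⟨z, rfl⟩
    rw [LinearMap.sub_apply, outer_apply, outer_apply]
    exact Submodule.sub_mem _ (Submodule.smul_mem _ _ (Submodule.subset_span (by simp)))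
      (Submodule.smul_mem _ _ (Submodule.subset_span (by simp)))
  exact (Submodule.finrank_mono h).trans ((finrank_span_finset_le_card _).trans Finset.card_le_two)

variable [FiniteDimensional 𝕜 H]

theorem matDist_phaseClass (q : ℝ≥0∞) (x y : H) :
    matDist q (phaseClass 𝕜 x) (phaseClass 𝕜 y) =
      schattenNorm q (outer (𝕜 := 𝕜) x - outer (𝕜 := 𝕜) y) := rfl

theorem schattenNorm_two_sq (T : H →ₗ[𝕜] H) :
    schattenNorm 2 T ^ 2 = RCLike.re (LinearMap.trace 𝕜 H (T.adjoint ∘ₗ T)) := by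
  rw [T.isSymmetric_adjoint_comp_self.re_trace_eq_sum_eigenvalues rfl, schattenNorm, lpNorm_two_sq]
  refine Finset.sum_congr rfl fun i _ => ?_
  rw [Real.norm_eq_abs, sq_abs, T.sq_singularValues_fin rfl]

theorem trace_outer_comp_outer (x y : H) :
    LinearMap.trace 𝕜 H (outer x ∘ₗ outer y) = ((‖inner 𝕜 x y‖ ^ 2 : ℝ) : 𝕜) := by
  have : outer x ∘ₗ outer y =
      inner 𝕜 x y • (InnerProductSpace.rankOne 𝕜 x y).toLinearMap := by
    ext z
    simp only [LinearMap.comp_apply, outer_apply, LinearMap.smul_apply, inner_smul_right,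
      ContinuousLinearMap.coe_coe, InnerProductSpace.rankOne_apply, smul_smul]
    ring_nf
  rw [this, map_smul, InnerProductSpace.trace_rankOne, smul_eq_mul, ← inner_conj_symm y x,
    RCLike.mul_conj]
  push_cast
  rfl

/-- The Frobenius norm of `xx^* - yy^*`. -/
theorem matDist_two_sq (x y : H) :
    matDist 2 (phaseClass 𝕜 x) (phaseClass 𝕜 y) ^ 2 =
      ‖x‖ ^ 4 + ‖y‖ ^ 4 - 2 * ‖inner 𝕜 x y‖ ^ 2 := by
  have hs : (outer (𝕜 := 𝕜) x - outer y).IsSymmetric :=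
    (isSymmetric_outer x).sub (isSymmetric_outer y)
  rw [matDist_phaseClass, schattenNorm_two_sq, hs.adjoint_eq,
    LinearMap.sub_comp, LinearMap.comp_sub, LinearMap.comp_sub]
  simp only [map_sub, trace_outer_comp_outer, RCLike.ofReal_re, norm_inner_symm y x,
    inner_self_eq_norm_sq_to_K, norm_pow, RCLike.norm_ofReal, abs_norm]
  ring

theorem matDist_nonneg {q : ℝ≥0∞} (h1 : 1 ≤ q) (X Y : PhaseQuotient 𝕜 H) :
    0 ≤ matDist q X Y := by
  obtain ⟨x, rfl⟩ := exists_phaseClass X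
  obtain ⟨y, rfl⟩ := exists_phaseClass Y
  exact lpNorm_nonneg h1 _

theorem matDist_antitone {p q : ℝ≥0∞} (h1 : 1 ≤ p) (hpq : p ≤ q) (X Y : PhaseQuotient 𝕜 H) :
    matDist q X Y ≤ matDist p X Y := by
  obtain ⟨x, rfl⟩ := exists_phaseClass X
  obtain ⟨y, rfl⟩ := exists_phaseClass Y
  exact lpNorm_le_lpNorm h1 hpq _

/-- As `xx^* - yy^*` has rank at most two, its Schatten norms are comparable with constants that do
not depend on the dimension. -/
theorem matDist_le_two_rpow_mul {p q : ℝ≥0∞} (h1 : 1 ≤ p) (hpq : p ≤ q) (X Y : PhaseQuotient 𝕜 H) :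
    matDist p X Y ≤ (2 : ℝ) ^ (1 / p.toReal - 1 / q.toReal) * matDist q X Y := by
  obtain ⟨x, rfl⟩ := exists_phaseClass X
  obtain ⟨y, rfl⟩ := exists_phaseClass Y
  rw [matDist_phaseClass, matDist_phaseClass]
  set T := outer (𝕜 := 𝕜) x - outer y with hT
  let s : Finset (Fin (Module.finrank 𝕜 H)) := {i | (i : ℕ) < 2}
  have hs : ∀ i ∉ s, T.singularValues i = 0 := by
    intro i hi
    rw [LinearMap.singularValues_eq_zero_iff_le_finrank_range]
    have : ¬ (i : ℕ) < 2 := by simpa [s] using hi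
    exact (finrank_range_outer_sub_le x y).trans (not_lt.1 this)
  have hcard : s.card ≤ 2 := by
    have : s.card ≤ (Finset.range 2).card :=
      Finset.card_le_card_of_injOn (fun i => (i : ℕ)) (by intro i; simp [s])
        (fun i _ j _ h => Fin.ext h)
    simpa using this
  refine (lpNorm_le_card_rpow_mul h1 hpq (fun i => T.singularValues (i : ℕ)) s hs).trans ?_
  refine mul_le_mul_of_nonneg_right ?_ (lpNorm_nonneg (h1.trans hpq) _)
  refine Real.rpow_le_rpow (by positivity) (by exact_mod_cast hcard) ?_
  rw [sub_nonneg, one_div, one_div]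
  rw [← ENNReal.toReal_inv, ← ENNReal.toReal_inv]
  exact ENNReal.toReal_mono (by simp; positivity) (ENNReal.inv_le_inv.2 hpq)

end MatDist

end Distances

/-! ### Kirszbraun's theorem -/

section Kirszbraun

variable {X E : Type*} [NormedAddCommGroup X] [InnerProductSpace ℝ X]
  [NormedAddCommGroup E] [InnerProductSpace ℝ E]

/-- The parallel axis formula for a weighted family of points. -/
theorem sum_sum_mul_norm_sub_sq {ι : Type*} [Fintype ι] (w : ι → ℝ) (hw : ∑ i, w i = 1)
    (v : ι → E) (p : E) :
    ∑ i, ∑ j, w i * w j * ‖v i - v j‖ ^ 2 =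
      2 * ∑ i, w i * ‖v i - p‖ ^ 2 - 2 * ‖(∑ i, w i • v i) - p‖ ^ 2 := by
  have hp : (∑ i, w i • v i) - p = ∑ i, w i • (v i - p) := by
    simp only [smul_sub, Finset.sum_sub_distrib, ← Finset.sum_smul, hw, one_smul]
  have hij : ∀ i j, w i * w j * ‖v i - v j‖ ^ 2 =
      w j * (w i * ‖v i - p‖ ^ 2) + w i * (w j * ‖v j - p‖ ^ 2)
        - 2 * (w i * (w j * inner ℝ (v i - p) (v j - p))) := by
    intro i j
    rw [← sub_sub_sub_cancel_right (v i) (v j) p, norm_sub_sq_real]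
    ring
  have hsq : ‖∑ i, w i • (v i - p)‖ ^ 2 =
      ∑ i, w i * ∑ j, w j * inner ℝ (v i - p) (v j - p) := by
    rw [← real_inner_self_eq_norm_sq, sum_inner]
    refine Finset.sum_congr rfl fun i _ => ?_
    rw [real_inner_smul_left, inner_sum]
    simp only [real_inner_smul_right]
  rw [hp, hsq]
  simp only [hij, Finset.sum_sub_distrib, Finset.sum_add_distrib, ← Finset.mul_sum,
    ← Finset.sum_mul, hw]
  ring

/-- Finitely many balls whose centres are images of points under a Lipschitz map meet. -/
theorem exists_forall_norm_sub_le_of_fintype {ι : Type*} [Fintype ι] {L : ℝ} (hL : 0 ≤ L)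
    (x : ι → X) (y : ι → E) (h : ∀ i j, ‖y i - y j‖ ≤ L * ‖x i - x j‖) (x₀ : X) :
    ∃ z, ∀ i, ‖z - y i‖ ≤ L * ‖x₀ - x i‖ := by
  classical
  rcases isEmpty_or_nonempty ι with hι | hι
  · exact ⟨0, fun i => hι.elim i⟩
  let r : ι → ℝ := fun i => L * ‖x₀ - x i‖
  obtain ⟨a, -, w, hw, hs⟩ := Sion.exists_isSaddlePointOn
    (X := convexHull ℝ (Set.range y)) (Y := stdSimplex ℝ ι)
    (f := fun z w => ∑ i, w i * (‖z - y i‖ ^ 2 - r i ^ 2))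
    (Set.range_nonempty y).convexHull (convex_convexHull ℝ _)
    ((Set.finite_range y).isCompact_convexHull ℝ)
    (fun w _ => (by fun_prop : Continuous fun z : E =>
      ∑ i, w i * (‖z - y i‖ ^ 2 - r i ^ 2)).lowerSemicontinuous.lowerSemicontinuousOn _)
    (fun w hw => by
      refine ConvexOn.quasiconvexOn ⟨convex_convexHull ℝ _, fun u hu v hv a b ha hb hab => ?_⟩
      simp only [smul_eq_mul, Finset.mul_sum]
      rw [← Finset.sum_add_distrib]
      refine Finset.sum_le_sum fun i _ => ?_
      have hcvx : ConvexOn ℝ Set.univ fun z => dist z (y i) ^ 2 :=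
        (convexOn_dist (y i) convex_univ).pow (fun _ _ => dist_nonneg) 2
      have := hcvx.2 (Set.mem_univ u) (Set.mem_univ v) ha hb hab
      simp only [dist_eq_norm, smul_eq_mul] at this
      calc _ ≤ w i * (a * ‖u - y i‖ ^ 2 + b * ‖v - y i‖ ^ 2 - (a + b) * r i ^ 2) := by
            rw [hab, one_mul]
            exact mul_le_mul_of_nonneg_left (by linarith) (hw.1 i)
        _ = _ := by ring)
    (convex_stdSimplex ℝ ι)
    ⟨_, single_mem_stdSimplex ℝ (Classical.arbitrary ι)⟩
    (isCompact_stdSimplex ℝ ι)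
    (fun z _ => (by fun_prop : Continuous fun w : ι → ℝ =>
      ∑ i, w i * (‖z - y i‖ ^ 2 - r i ^ 2)).upperSemicontinuous.upperSemicontinuousOn _)
    (fun z _ => by
      refine ConcaveOn.quasiconcaveOn ⟨convex_stdSimplex ℝ ι, fun u _ v _ a b _ _ _ => ?_⟩
      simp only [Pi.add_apply, Pi.smul_apply, smul_eq_mul, add_mul, Finset.sum_add_distrib,
        Finset.mul_sum, mul_assoc]
      exact le_rfl)
  have hbar : ∑ i, w i • y i ∈ convexHull ℝ (Set.range y) :=
    (convex_convexHull ℝ _).sum_mem (fun i _ => hw.1 i) hw.2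
      fun i _ => subset_convexHull ℝ _ ⟨i, rfl⟩
  -- At the barycentre the weighted sum is nonpositive, because the weighted mean square distance
  -- to the barycentre is half the weighted sum of the squared mutual distances.
  have hneg : ∑ i, w i * (‖(∑ i, w i • y i) - y i‖ ^ 2 - r i ^ 2) ≤ 0 := by
    have h1 := sum_sum_mul_norm_sub_sq w hw.2 y (∑ i, w i • y i)
    have h2 := sum_sum_mul_norm_sub_sq w hw.2 x x₀
    have h3 : ∑ i, ∑ j, w i * w j * ‖y i - y j‖ ^ 2 ≤
        L ^ 2 * ∑ i, ∑ j, w i * w j * ‖x i - x j‖ ^ 2 := by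
      rw [Finset.mul_sum]
      refine Finset.sum_le_sum fun i _ => ?_
      rw [Finset.mul_sum]
      refine Finset.sum_le_sum fun j _ => ?_
      have hsq := pow_le_pow_left₀ (norm_nonneg _) (h i j) 2
      calc _ ≤ w i * w j * (L * ‖x i - x j‖) ^ 2 :=
            mul_le_mul_of_nonneg_left hsq (mul_nonneg (hw.1 i) (hw.1 j))
        _ = _ := by ring
    have h4 : ∑ i, w i * r i ^ 2 = L ^ 2 * ∑ i, w i * ‖x i - x₀‖ ^ 2 := by
      rw [Finset.mul_sum]
      refine Finset.sum_congr rfl fun i _ => ?_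
      simp only [r, norm_sub_rev x₀]
      ring
    rw [h1, h2, sub_self, norm_zero] at h3
    simp only [mul_sub, Finset.sum_sub_distrib, h4]
    simp only [norm_sub_rev _ (y _)]
    nlinarith [mul_nonneg (sq_nonneg L) (sq_nonneg ‖(∑ i, w i • x i) - x₀‖)]
  refine ⟨a, fun i => ?_⟩
  have := (hs _ hbar _ (single_mem_stdSimplex ℝ i)).trans hneg
  simp only [Pi.single_apply, ite_mul, one_mul, zero_mul, Finset.sum_ite_eq', Finset.mem_univ,
    if_true] at this
  exact le_of_sq_le_sq (by linarith) (by positivity)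

/-- A Lipschitz relation extends to one more point. -/
theorem exists_forall_norm_sub_le [FiniteDimensional ℝ E] {L : ℝ} (hL : 0 ≤ L) (G : Set (X × E))
    (hG : ∀ u ∈ G, ∀ v ∈ G, ‖u.2 - v.2‖ ≤ L * ‖u.1 - v.1‖) (x₀ : X) :
    ∃ z, ∀ u ∈ G, ‖z - u.2‖ ≤ L * ‖x₀ - u.1‖ := by
  classical
  have : ProperSpace E := FiniteDimensional.proper ℝ E
  rcases G.eq_empty_or_nonempty with rfl | ⟨u₀, hu₀⟩
  · exact ⟨0, by simp⟩
  obtain ⟨z, -, hz⟩ := (isCompact_closedBall u₀.2 (L * ‖x₀ - u₀.1‖)).inter_iInter_nonempty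
    (fun u : G => Metric.closedBall u.1.2 (L * ‖x₀ - u.1.1‖)) (fun u => Metric.isClosed_closedBall)
    (fun s => by
      let t : Finset G := insert ⟨u₀, hu₀⟩ s
      obtain ⟨z, hz⟩ := exists_forall_norm_sub_le_of_fintype hL (fun u : t => u.1.1.1)
        (fun u : t => u.1.1.2) (fun u v => hG _ u.1.2 _ v.1.2) x₀
      refine ⟨z, ?_, ?_⟩
      · rw [Metric.mem_closedBall, dist_eq_norm]
        exact hz ⟨⟨u₀, hu₀⟩, Finset.mem_insert_self _ _⟩
      · simp only [Set.mem_iInter, Metric.mem_closedBall, dist_eq_norm]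
        exact fun u hu => hz ⟨u, Finset.mem_insert_of_mem hu⟩)
  refine ⟨z, fun u hu => ?_⟩
  have := Set.mem_iInter.1 hz ⟨u, hu⟩
  rwa [Metric.mem_closedBall, dist_eq_norm] at this

/-- **Kirszbraun's theorem**, for a finite-dimensional target: a Lipschitz map given on part of an
inner product space (the values `k i` at the points `g i`) extends to the whole space with the same
constant. -/
theorem exists_lipschitz_extension [FiniteDimensional ℝ E] {L : ℝ} (hL : 0 ≤ L) {ι : Type*}
    (g : ι → X) (k : ι → E) (h : ∀ i j, ‖k i - k j‖ ≤ L * ‖g i - g j‖) :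
    ∃ F : X → E, (∀ i, F (g i) = k i) ∧ ∀ c d, ‖F c - F d‖ ≤ L * ‖c - d‖ := by
  let S : Set (Set (X × E)) := {G | ∀ u ∈ G, ∀ v ∈ G, ‖u.2 - v.2‖ ≤ L * ‖u.1 - v.1‖}
  obtain ⟨G, hsub, hG⟩ := zorn_subset_nonempty S
    (fun c hc hchain _ => ⟨⋃₀ c, by
      rintro u ⟨s, hs, hu⟩ v ⟨t, ht, hv⟩
      rcases hchain.total hs ht with hst | hst
      · exact hc ht u (hst hu) v hv
      · exact hc hs u hu v (hst hv), fun s hs => Set.subset_sUnion_of_mem hs⟩)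
    (Set.range fun i => (g i, k i)) (by
      rintro _ ⟨i, rfl⟩ _ ⟨j, rfl⟩
      exact h i j)
  have hex : ∀ x, ∃ z, (x, z) ∈ G := by
    intro x
    obtain ⟨z, hz⟩ := exists_forall_norm_sub_le hL G hG.1 x
    refine ⟨z, hG.2 (y := insert (x, z) G) ?_ (Set.subset_insert _ _) (Set.mem_insert _ _)⟩
    rintro u (rfl | hu) v (rfl | hv)
    · simp
    · exact hz v hv
    · rw [norm_sub_rev, norm_sub_rev u.1]
      exact hz u hu
    · exact hG.1 u hu v hv
  choose F hF using hex
  refine ⟨F, fun i => ?_, fun c d => hG.1 _ (hF c) _ (hF d)⟩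
  have := hG.1 _ (hF (g i)) _ (hsub ⟨i, rfl⟩)
  simpa [sub_eq_zero] using this

end Kirszbraun

universe u v

/-! ### A Lipschitz retraction onto the matrices `xx^*` -/

section FrobeniusLift

variable {𝕜 H E : Type*} [RCLike 𝕜] [NormedAddCommGroup H] [InnerProductSpace 𝕜 H]
  [NormedAddCommGroup E] [InnerProductSpace ℝ E]

variable (𝕜) in
/-- `K x` plays the role of the matrix `xx^*` in the real Hilbert space `E` of matrices with the
Frobenius inner product. Only two facts about matrices are kept: `⟨xx^*, yy^*⟩ = |⟨x, y⟩|²`, and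
pairing a matrix with the rank one matrices gives the quadratic form of a symmetric operator. -/
structure IsFrobeniusLift (K : H → E) : Prop where
  inner_eq : ∀ x y, inner ℝ (K x) (K y) = ‖inner 𝕜 x y‖ ^ 2
  exists_isSymmetric : ∀ A : E, ∃ T : H →ₗ[𝕜] H, T.IsSymmetric ∧
    ∀ x, inner ℝ A (K x) = RCLike.re (inner 𝕜 (T x) x)

/-- A lift into a Hilbert space over `𝕜` gives one into the underlying real Hilbert space; the
operator representing the functional of a matrix is symmetrised. -/
theorem exists_isFrobeniusLift_of_inner_eq {𝕜 : Type u} {H : Type v} [RCLike 𝕜]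
    [NormedAddCommGroup H] [InnerProductSpace 𝕜 H] [FiniteDimensional 𝕜 H]
    {F : Type u} [NormedAddCommGroup F] [InnerProductSpace 𝕜 F] [FiniteDimensional 𝕜 F] (K : H → F)
    (h : ∀ x y, inner 𝕜 (K x) (K y) = inner 𝕜 x y * (starRingEnd 𝕜) (inner 𝕜 x y))
    (hrepr : ∀ A : F, ∃ S : H →ₗ[𝕜] H, ∀ x, inner 𝕜 x (S x) = inner 𝕜 A (K x)) :
    ∃ (F : Type u) (_ : NormedAddCommGroup F) (_ : InnerProductSpace ℝ F)
      (_ : FiniteDimensional ℝ F) (K : H → F), IsFrobeniusLift 𝕜 K := by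
  let _ : InnerProductSpace ℝ F := InnerProductSpace.rclikeToReal 𝕜 F
  have : ProperSpace F := FiniteDimensional.proper 𝕜 F
  have hfin : FiniteDimensional ℝ F := FiniteDimensional.of_locallyCompactSpace ℝ
  refine ⟨F, inferInstance, inferInstance, hfin, K, fun x y => ?_, fun A => ?_⟩
  · change RCLike.re (inner 𝕜 (K x) (K y)) = _
    rw [h, RCLike.mul_conj, ← RCLike.ofReal_pow, RCLike.ofReal_re]
  · obtain ⟨S, hS⟩ := hrepr A
    refine ⟨((1 / 2 : ℝ) : 𝕜) • (S + S.adjoint), fun x y => ?_, fun x => ?_⟩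
    · simp only [LinearMap.smul_apply, LinearMap.add_apply, inner_smul_left, inner_smul_right,
        RCLike.conj_ofReal, inner_add_left, inner_add_right, LinearMap.adjoint_inner_left,
        LinearMap.adjoint_inner_right]
      ring
    · change RCLike.re (inner 𝕜 A (K x)) = _
      simp only [LinearMap.smul_apply, LinearMap.add_apply, inner_smul_left,
        RCLike.conj_ofReal, inner_add_left, LinearMap.adjoint_inner_left, RCLike.re_ofReal_mul,
        map_add]
      rw [← inner_conj_symm (S x) x, RCLike.conj_re, hS]
      ring

/-- The space of `n × n` matrices over `𝕜`, regarded as a real Hilbert space, with the matrices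
`xx^*` in a given orthonormal basis. -/
theorem exists_isFrobeniusLift {𝕜 : Type u} {H : Type v} [RCLike 𝕜] [NormedAddCommGroup H]
    [InnerProductSpace 𝕜 H] [FiniteDimensional 𝕜 H] {n : ℕ}
    (b : OrthonormalBasis (Fin n) 𝕜 H) :
    ∃ (F : Type u) (_ : NormedAddCommGroup F) (_ : InnerProductSpace ℝ F)
      (_ : FiniteDimensional ℝ F) (K : H → F), IsFrobeniusLift 𝕜 K := by
  let K : H → EuclideanSpace 𝕜 (Fin n × Fin n) := fun x =>
    WithLp.toLp 2 fun ij => b.repr x ij.1 * (starRingEnd 𝕜) (b.repr x ij.2)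
  refine exists_isFrobeniusLift_of_inner_eq K (fun x y => ?_) fun A => ?_
  · rw [← b.repr.inner_map_map x y]
    simp only [PiLp.inner_apply, RCLike.inner_apply, map_sum, Finset.sum_mul_sum,
      Fintype.sum_prod_type, K, map_mul, RCLike.conj_conj]
    refine Finset.sum_congr rfl fun i _ => Finset.sum_congr rfl fun j _ => ?_
    ring
  · refine ⟨∑ i, ∑ j,
      (starRingEnd 𝕜) (A (i, j)) • (InnerProductSpace.rankOne 𝕜 (b j) (b i)).toLinearMap,
      fun x => ?_⟩
    simp only [LinearMap.sum_apply, LinearMap.smul_apply, ContinuousLinearMap.coe_coe,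
      InnerProductSpace.rankOne_apply, inner_sum, inner_smul_right, PiLp.inner_apply,
      RCLike.inner_apply, Fintype.sum_prod_type, K, b.repr_apply_apply, inner_conj_symm]
    refine Finset.sum_congr rfl fun i _ => Finset.sum_congr rfl fun j _ => ?_
    ring

namespace IsFrobeniusLift

variable {K : H → E} (hK : IsFrobeniusLift 𝕜 K)
include hK

theorem norm_eq (x : H) : ‖K x‖ = ‖x‖ ^ 2 := by
  have h := hK.inner_eq x x
  rw [real_inner_self_eq_norm_sq, inner_self_eq_norm_sq_to_K, norm_pow, RCLike.norm_ofReal,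
    abs_norm] at h
  exact (pow_left_inj₀ (norm_nonneg _) (by positivity) two_ne_zero).1 h

theorem norm_smul_sub_smul_sq (r s : ℝ) (x y : H) :
    ‖r • K x - s • K y‖ ^ 2 =
      r ^ 2 * ‖x‖ ^ 4 + s ^ 2 * ‖y‖ ^ 4 - 2 * (r * s * ‖inner 𝕜 x y‖ ^ 2) := by
  rw [norm_sub_sq_real, real_inner_smul_left, real_inner_smul_right, hK.inner_eq, norm_smul,
    norm_smul, hK.norm_eq, hK.norm_eq, mul_pow, mul_pow, Real.norm_eq_abs, Real.norm_eq_abs,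
    sq_abs, sq_abs]
  ring

theorem norm_sub_sq (x y : H) :
    ‖K x - K y‖ ^ 2 = ‖x‖ ^ 4 + ‖y‖ ^ 4 - 2 * ‖inner 𝕜 x y‖ ^ 2 := by
  simpa using hK.norm_smul_sub_smul_sq 1 1 x y

theorem map_smul (c : 𝕜) (x : H) : K (c • x) = ‖c‖ ^ 2 • K x := by
  have h := hK.norm_smul_sub_smul_sq 1 (‖c‖ ^ 2) (c • x) x
  rw [one_smul, inner_smul_left, norm_smul, norm_mul, RCLike.norm_conj,
    inner_self_eq_norm_sq_to_K, norm_pow, RCLike.norm_ofReal, abs_norm] at h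
  rw [← sub_eq_zero, ← norm_eq_zero, ← sq_eq_zero_iff, h]
  ring

end IsFrobeniusLift

/-- `u` is a unit top eigenvector of the symmetric part of the matrix `A`, with largest and second
largest eigenvalues `l₁` and `l₂`; everything is phrased through the quadratic form
`x ↦ ⟨A, K x⟩` so that no spectral theory is needed to compare two matrices. -/
structure IsTopPair (𝕜 : Type*) {H E : Type*} [RCLike 𝕜] [NormedAddCommGroup H]
    [InnerProductSpace 𝕜 H] [NormedAddCommGroup E] [InnerProductSpace ℝ E]
    (K : H → E) (A : E) (u : H) (l₁ l₂ : ℝ) : Prop where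
  norm_eq : ‖u‖ = 1
  le : l₂ ≤ l₁
  apply_self : inner ℝ A (K u) = l₁
  apply_le : ∀ x, inner ℝ A (K x) ≤ l₁ * ‖inner 𝕜 u x‖ ^ 2 + l₂ * (‖x‖ ^ 2 - ‖inner 𝕜 u x‖ ^ 2)
  exists_le : ∀ v : H, ∃ x, x ≠ 0 ∧ inner 𝕜 v x = 0 ∧ l₂ * ‖x‖ ^ 2 ≤ inner ℝ A (K x)

variable {K : H → E}

/-- The top two eigenvalues are Lipschitz, and hence their difference. -/
theorem IsTopPair.sub_le (hK : IsFrobeniusLift 𝕜 K) {A B : E} {u v : H} {l₁ l₂ m₁ m₂ : ℝ}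
    (hA : IsTopPair 𝕜 K A u l₁ l₂) (hB : IsTopPair 𝕜 K B v m₁ m₂) :
    l₁ ≤ m₁ + ‖A - B‖ ∧ l₂ ≤ m₂ + ‖A - B‖ := by
  have key : ∀ x, inner ℝ A (K x) - inner ℝ B (K x) ≤ ‖A - B‖ * ‖x‖ ^ 2 := by
    intro x
    rw [← inner_sub_left, ← hK.norm_eq]
    exact real_inner_le_norm _ _
  constructor
  · have h1 := key u
    have h2 := hB.apply_le u
    have h3 : ‖inner 𝕜 v u‖ ≤ 1 := by
      simpa [hA.norm_eq, hB.norm_eq] using norm_inner_le_norm (𝕜 := 𝕜) v u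
    rw [hA.apply_self, hA.norm_eq] at h1
    rw [hA.norm_eq] at h2
    nlinarith [hB.le, mul_nonneg (sub_nonneg.2 hB.le)
      (sub_nonneg.2 (pow_le_one₀ (n := 2) (norm_nonneg _) h3))]
  · obtain ⟨x, hx, hvx, h⟩ := hA.exists_le v
    have h1 := key x
    have h2 := hB.apply_le x
    rw [hvx, norm_zero] at h2
    have hx2 : 0 < ‖x‖ ^ 2 := by positivity
    nlinarith

/-- The map sending a matrix to the gap between its two largest eigenvalues times the projection
onto the top eigenvector is Lipschitz. -/
theorem IsTopPair.norm_sub_le (hK : IsFrobeniusLift 𝕜 K) {A B : E} {u v : H} {l₁ l₂ m₁ m₂ : ℝ}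
    (hA : IsTopPair 𝕜 K A u l₁ l₂) (hB : IsTopPair 𝕜 K B v m₁ m₂) :
    ‖(l₁ - l₂) • K u - (m₁ - m₂) • K v‖ ≤ √5 * ‖A - B‖ := by
  obtain ⟨hAB₁, hAB₂⟩ := hA.sub_le hK hB
  obtain ⟨hBA₁, hBA₂⟩ := hB.sub_le hK hA
  rw [norm_sub_rev] at hBA₁ hBA₂
  have hg := sub_nonneg.2 hA.le
  have hh := sub_nonneg.2 hB.le
  have hu := hA.apply_le v
  have hv := hB.apply_le u
  rw [hB.norm_eq] at hu
  rw [hA.norm_eq, norm_inner_symm] at hv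
  have hc : ‖inner 𝕜 u v‖ ^ 2 ≤ 1 := by
    refine pow_le_one₀ (norm_nonneg _) ?_
    simpa [hA.norm_eq, hB.norm_eq] using norm_inner_le_norm (𝕜 := 𝕜) u v
  have hdiff := hK.norm_sub_sq u v
  have hsq := hK.norm_smul_sub_smul_sq (l₁ - l₂) (m₁ - m₂) u v
  rw [hA.norm_eq, hB.norm_eq] at hdiff hsq
  -- Both top eigenvectors maximise their quadratic forms, with a quadratic loss governed by the gap;
  -- adding the two inequalities bounds the angle between them.
  have hinner : (l₁ - l₂ + (m₁ - m₂)) * (1 - ‖inner 𝕜 u v‖ ^ 2) ≤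
      ‖A - B‖ * ‖K u - K v‖ := by
    refine le_trans ?_ (real_inner_le_norm (A - B) (K u - K v))
    rw [inner_sub_left, inner_sub_right, inner_sub_right, hA.apply_self, hB.apply_self]
    linarith
  have hangle : (l₁ - l₂ + (m₁ - m₂)) ^ 2 * (1 - ‖inner 𝕜 u v‖ ^ 2) ≤ 2 * ‖A - B‖ ^ 2 := by
    rcases hc.eq_or_lt with h1 | h1
    · rw [h1]
      nlinarith [sq_nonneg ‖A - B‖]
    · have h2 := pow_le_pow_left₀ (mul_nonneg (add_nonneg hg hh) (sub_nonneg.2 hc)) hinner 2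
      rw [mul_pow, mul_pow _ ‖K u - K v‖, hdiff] at h2
      refine le_of_mul_le_mul_right ?_ (sub_pos.2 h1)
      linarith
  have habs : (l₁ - l₂ - (m₁ - m₂)) ^ 2 ≤ (2 * ‖A - B‖) ^ 2 := by
    refine sq_le_sq' ?_ ?_ <;> linarith
  refine le_of_sq_le_sq ?_ (by positivity)
  rw [hsq, mul_pow, Real.sq_sqrt (by norm_num)]
  nlinarith [mul_nonneg (sq_nonneg (l₁ - l₂ - (m₁ - m₂))) (sub_nonneg.2 hc)]

/-- If `H` has dimension at least two, every matrix has a top eigenvector. -/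
theorem exists_isTopPair [FiniteDimensional 𝕜 H] (hK : IsFrobeniusLift 𝕜 K)
    (hn : 1 < Module.finrank 𝕜 H) (A : E) : ∃ u l₁ l₂, IsTopPair 𝕜 K A u l₁ l₂ := by
  obtain ⟨T, hT, hAT⟩ := hK.exists_isSymmetric A
  let e := hT.eigenvectorBasis rfl
  let l := hT.eigenvalues rfl
  let i₀ : Fin (Module.finrank 𝕜 H) := ⟨0, by omega⟩
  let i₁ : Fin (Module.finrank 𝕜 H) := ⟨1, hn⟩
  have h01 : i₀ ≠ i₁ := by simp [i₀, i₁]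
  have hle : ∀ i, i ≠ i₀ → l i ≤ l i₁ := by
    intro i hi
    refine hT.eigenvalues_antitone rfl (Fin.le_def.2 ?_)
    have : (i : ℕ) ≠ 0 := fun h => hi (Fin.ext h)
    change 1 ≤ (i : ℕ)
    omega
  have hle' : l i₁ ≤ l i₀ := hT.eigenvalues_antitone rfl (Fin.le_def.2 (by simp [i₀, i₁]))
  have hQ : ∀ x, inner ℝ A (K x) = ∑ i, l i * ‖inner 𝕜 (e i) x‖ ^ 2 := by
    intro x
    rw [hAT, ← e.repr.inner_map_map, PiLp.inner_apply, map_sum]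
    refine Finset.sum_congr rfl fun i _ => ?_
    rw [hT.eigenvectorBasis_apply_self_apply rfl, RCLike.inner_apply, RingHom.map_mul,
      RCLike.conj_ofReal,
      mul_left_comm, RCLike.mul_conj, ← RCLike.ofReal_pow, ← RCLike.ofReal_mul, RCLike.ofReal_re,
      e.repr_apply_apply]
  have hnorm : ∀ x, ‖x‖ ^ 2 = ∑ i, ‖inner 𝕜 (e i) x‖ ^ 2 := fun x =>
    (e.sum_sq_norm_inner_right x).symm
  refine ⟨e i₀, l i₀, l i₁, e.norm_eq_one _, hle', ?_, fun x => ?_, fun v => ?_⟩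
  · rw [hQ, Finset.sum_eq_single i₀]
    · simp [e.norm_eq_one]
    · intro i _ hi
      simp [e.inner_eq_zero hi]
    · simp
  · rw [hQ, hnorm, ← Finset.add_sum_erase _ _ (Finset.mem_univ i₀),
      ← Finset.add_sum_erase (a := i₀) Finset.univ (fun i => ‖inner 𝕜 (e i) x‖ ^ 2)
        (Finset.mem_univ i₀), add_sub_cancel_left, Finset.mul_sum]
    gcongr with i hi
    exact hle i (Finset.ne_of_mem_erase hi)
  · -- Some nonzero combination of the top two eigenvectors is orthogonal to `v`.
    obtain ⟨s, t, hst, hv⟩ : ∃ s t : 𝕜, (s ≠ 0 ∨ t ≠ 0) ∧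
        inner 𝕜 v (s • e i₀ + t • e i₁) = 0 := by
      by_cases h : inner 𝕜 v (e i₀) = 0
      · exact ⟨1, 0, by simp, by simp [h]⟩
      · refine ⟨inner 𝕜 v (e i₁), -inner 𝕜 v (e i₀), Or.inr (neg_ne_zero.2 h), ?_⟩
        rw [inner_add_right, inner_smul_right, inner_smul_right]
        ring
    have hcoord : ∀ i, inner 𝕜 (e i) (s • e i₀ + t • e i₁) =
        if i = i₀ then s else if i = i₁ then t else 0 := by
      intro i
      rw [inner_add_right, inner_smul_right, inner_smul_right, e.inner_eq_ite, e.inner_eq_ite]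
      by_cases h0 : i = i₀
      · simp [h0, h01]
      · by_cases h1 : i = i₁ <;> simp [h0, h1, h01.symm]
    refine ⟨s • e i₀ + t • e i₁, fun h0 => ?_, hv, ?_⟩
    · have hs := hcoord i₀
      have ht := hcoord i₁
      rw [h0, inner_zero_right] at hs ht
      simp only [if_true, h01.symm, if_false] at hs ht
      rcases hst with h | h
      · exact h hs.symm
      · exact h ht.symm
    · rw [hQ, hnorm, Finset.mul_sum]
      refine Finset.sum_le_sum fun i _ => ?_
      rw [hcoord]
      by_cases h0 : i = i₀
      · simp only [h0, if_true]
        gcongr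
      · by_cases h1 : i = i₁ <;> simp [h0, h1, h01.symm]

/-- A nonnegative multiple of a rank one projection is its own top part. -/
theorem isTopPair_smul [FiniteDimensional 𝕜 H] (hK : IsFrobeniusLift 𝕜 K)
    (hn : 1 < Module.finrank 𝕜 H) {u : H} (hu : ‖u‖ = 1) {r : ℝ} (hr : 0 ≤ r) :
    IsTopPair 𝕜 K (r • K u) u r 0 where
  norm_eq := hu
  le := hr
  apply_self := by
    rw [real_inner_smul_left, real_inner_self_eq_norm_sq, hK.norm_eq, hu]
    ring
  apply_le x := by
    rw [real_inner_smul_left, hK.inner_eq]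
    simp
  exists_le v := by
    have h : (𝕜 ∙ v)ᗮ ≠ ⊥ := by
      intro h
      have h1 := Submodule.finrank_add_finrank_orthogonal (𝕜 ∙ v)
      have h2 : Module.finrank 𝕜 (𝕜 ∙ v) ≤ 1 := by
        simpa using finrank_span_le_card (R := 𝕜) ({v} : Set H)
      rw [h, finrank_bot] at h1
      omega
    obtain ⟨x, hx, hx0⟩ := Submodule.exists_mem_ne_zero_of_ne_bot h
    refine ⟨x, hx0, Submodule.mem_orthogonal_singleton_iff_inner_right.1 hx, ?_⟩
    rw [zero_mul, real_inner_smul_left, hK.inner_eq]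
    positivity

/-- The cone of matrices `xx^*` is a Lipschitz retract of the space of all matrices, with a constant
that does not depend on the dimension. -/
theorem exists_retraction [FiniteDimensional 𝕜 H] (hK : IsFrobeniusLift 𝕜 K) :
    ∃ π : E → E, (∀ A, ∃ x, π A = K x) ∧ (∀ x, π (K x) = K x) ∧
      ∀ A B, ‖π A - π B‖ ≤ √5 * ‖A - B‖ := by
  have hsmul : ∀ (r : ℝ) (u : H), 0 ≤ r → r • K u = K ((√r : 𝕜) • u) := by
    intro r u hr
    rw [hK.map_smul, RCLike.norm_ofReal, sq_abs, Real.sq_sqrt hr]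
  rcases lt_or_ge 1 (Module.finrank 𝕜 H) with hn | hn
  · choose u l₁ l₂ h using exists_isTopPair hK hn
    refine ⟨fun A => (l₁ A - l₂ A) • K (u A),
      fun A => ⟨_, hsmul _ _ (sub_nonneg.2 (h A).le)⟩, fun x => ?_,
      fun A B => (h A).norm_sub_le hK (h B)⟩
    obtain ⟨w, r, hw, hr, hx⟩ : ∃ (w : H) (r : ℝ), ‖w‖ = 1 ∧ 0 ≤ r ∧ K x = r • K w := by
      rcases eq_or_ne x 0 with rfl | hx
      · have : Nontrivial H := Module.nontrivial_of_finrank_pos (R := 𝕜) (by omega)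
        obtain ⟨z, hz⟩ := exists_ne (0 : H)
        obtain ⟨w, hw⟩ : ∃ w : H, ‖w‖ = 1 := ⟨_, norm_smul_inv_norm (𝕜 := 𝕜) hz⟩
        refine ⟨w, 0, hw, le_rfl, ?_⟩
        rw [zero_smul, ← norm_eq_zero, hK.norm_eq, norm_zero, zero_pow two_ne_zero]
      · refine ⟨((‖x‖⁻¹ : ℝ) : 𝕜) • x, ‖x‖ ^ 2, ?_, by positivity, ?_⟩
        · rw [norm_smul, RCLike.norm_ofReal, abs_inv, abs_norm,
            inv_mul_cancel₀ (norm_ne_zero_iff.2 hx)]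
        · rw [hK.map_smul, smul_smul, RCLike.norm_ofReal, sq_abs, ← mul_pow,
            mul_inv_cancel₀ (norm_ne_zero_iff.2 hx), one_pow, one_smul]
    have h1 := (h (r • K w)).norm_sub_le hK (isTopPair_smul hK hn hw hr)
    rw [sub_self, norm_zero, mul_zero, sub_zero, norm_le_zero_iff, sub_eq_zero] at h1
    rw [hx]
    exact h1
  · -- In dimension at most one the cone is a half-line, or a point.
    obtain ⟨e, he, hspan⟩ : ∃ e : H, ‖e‖ ≤ 1 ∧ ∀ x : H, ∃ c : 𝕜, ‖e‖ ^ 4 * ‖c‖ ^ 2 = ‖c‖ ^ 2 ∧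
        x = c • e := by
      obtain ⟨v, hv⟩ := finrank_le_one_iff.1 hn
      rcases eq_or_ne v 0 with rfl | hv0
      · exact ⟨0, by simp, fun x => ⟨0, by simp, by simpa using (hv x).choose_spec.symm⟩⟩
      · have he := norm_smul_inv_norm (𝕜 := 𝕜) hv0
        refine ⟨_, he.le, fun x => ?_⟩
        obtain ⟨c, rfl⟩ := hv x
        refine ⟨c * ‖v‖, by rw [he]; simp, ?_⟩
        rw [smul_smul, mul_assoc, mul_inv_cancel₀ (by simpa using hv0), mul_one]
    refine ⟨fun A => max (inner ℝ A (K e)) 0 • K e,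
      fun A => ⟨_, hsmul _ _ (le_max_right _ _)⟩, fun x => ?_, fun A B => ?_⟩
    · obtain ⟨c, hc, rfl⟩ := hspan x
      dsimp only
      rw [hK.map_smul, real_inner_smul_left, real_inner_self_eq_norm_sq, hK.norm_eq, ← pow_mul,
        max_eq_left (by positivity), mul_comm, hc]
    · have hKe : ‖K e‖ ≤ 1 := by
        rw [hK.norm_eq]
        exact pow_le_one₀ (norm_nonneg _) he
      have h5 : (1 : ℝ) ≤ √5 := Real.one_le_sqrt.2 (by norm_num)
      rw [← sub_smul, norm_smul, Real.norm_eq_abs]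
      calc |max (inner ℝ A (K e)) 0 - max (inner ℝ B (K e)) 0| * ‖K e‖
          ≤ (‖A - B‖ * 1) * 1 := by
            gcongr
            refine (abs_max_sub_max_le_abs _ _ _).trans ?_
            rw [← inner_sub_left]
            refine (abs_real_inner_le_norm _ _).trans ?_
            gcongr
        _ ≤ √5 * ‖A - B‖ := by
            nlinarith [norm_nonneg (A - B)]

end FrobeniusLift

/-! ### The normalised lift and the metric `D₂` -/

section RootLift

variable {𝕜 H E : Type*} [RCLike 𝕜] [NormedAddCommGroup H] [InnerProductSpace 𝕜 H]
  [NormedAddCommGroup E] [InnerProductSpace ℝ E]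

/-- The normalised lift `xx^* / ‖x‖`, the positive square root of `xx^*`. Its value at `0` is `0`,
as it should be. -/
noncomputable def rootLift (K : H → E) (x : H) : E := ‖x‖⁻¹ • K x

variable {K : H → E}

namespace IsFrobeniusLift

variable (hK : IsFrobeniusLift 𝕜 K)
include hK

theorem norm_rootLift (x : H) : ‖rootLift K x‖ = ‖x‖ := by
  rw [rootLift, norm_smul, hK.norm_eq, norm_inv, norm_norm]
  rcases eq_or_ne ‖x‖ 0 with h | h
  · simp [h]
  · field_simp

theorem norm_rootLift_sub_sq (x y : H) :
    ‖rootLift K x - rootLift K y‖ ^ 2 =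
      ‖x‖ ^ 2 + ‖y‖ ^ 2 - 2 * (‖inner 𝕜 x y‖ ^ 2 / (‖x‖ * ‖y‖)) := by
  have hinv : ∀ a : ℝ, a⁻¹ ^ 2 * a ^ 4 = a ^ 2 := by
    intro a
    rcases eq_or_ne a 0 with rfl | h
    · simp
    · field_simp
  rw [rootLift, rootLift, hK.norm_smul_sub_smul_sq, hinv, hinv, div_eq_inv_mul, mul_inv]

theorem eq_of_rootLift_eq {x y : H} (h : rootLift K x = rootLift K y) : K x = K y := by
  have hn : ‖x‖ = ‖y‖ := by rw [← hK.norm_rootLift, h, hK.norm_rootLift]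
  rcases eq_or_ne ‖x‖ 0 with h0 | h0
  · rw [norm_eq_zero.1 h0, norm_eq_zero.1 (hn.symm.trans h0)]
  · rw [rootLift, rootLift, ← hn] at h
    exact smul_right_injective E (inv_ne_zero h0) h

theorem exists_rootLift_eq (x : H) : ∃ z, rootLift K z = K x := by
  refine ⟨(‖x‖ : 𝕜) • x, ?_⟩
  rw [rootLift, hK.map_smul, norm_smul, RCLike.norm_ofReal, abs_norm, smul_smul]
  rcases eq_or_ne x 0 with rfl | h
  · rw [norm_zero, mul_zero, inv_zero, zero_mul, zero_smul]
    refine (norm_eq_zero.1 ?_).symm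
    rw [hK.norm_eq, norm_zero, zero_pow two_ne_zero]
  · have : ‖x‖ ≠ 0 := norm_ne_zero_iff.2 h
    rw [← sq, inv_mul_cancel₀ (pow_ne_zero 2 this), one_smul]

theorem exists_eq_rootLift (z : H) : ∃ x, K x = rootLift K z := by
  refine ⟨((√‖z‖⁻¹ : ℝ) : 𝕜) • z, ?_⟩
  rw [hK.map_smul, RCLike.norm_ofReal, sq_abs, Real.sq_sqrt (by positivity), rootLift]

end IsFrobeniusLift

variable {n : ℕ} (b : OrthonormalBasis (Fin n) 𝕜 H)

theorem natDist_two_sq (x y : H) :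
    natDist b 2 (phaseClass 𝕜 x) (phaseClass 𝕜 y) ^ 2 =
      ‖x‖ ^ 2 + ‖y‖ ^ 2 - 2 * ‖inner 𝕜 x y‖ := by
  obtain ⟨c, hc, h⟩ := RCLike.exists_norm_eq_mul_self (inner 𝕜 x y)
  have hin : inner 𝕜 x (c • y) = (‖inner 𝕜 x y‖ : 𝕜) := by rw [inner_smul_right, h]
  have hal : inner 𝕜 x (c • y) = (‖inner 𝕜 x (c • y)‖ : 𝕜) := by rw [hin]; simp
  have hy : phaseClass 𝕜 y = phaseClass 𝕜 (c • y) := phaseClass_eq_iff.2 ⟨c, hc, rfl⟩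
  rw [hy, natDist_two_aligned b hal, norm_sub_sq (𝕜 := 𝕜), hin,
    RCLike.ofReal_re, norm_smul, hc, one_mul]
  ring

variable (hK : IsFrobeniusLift 𝕜 K)
include hK

theorem natDist_two_le_norm_rootLift_sub (x y : H) :
    natDist b 2 (phaseClass 𝕜 x) (phaseClass 𝕜 y) ≤ ‖rootLift K x - rootLift K y‖ := by
  refine le_of_sq_le_sq ?_ (norm_nonneg _)
  rw [natDist_two_sq, hK.norm_rootLift_sub_sq]
  have h : ‖inner 𝕜 x y‖ ^ 2 / (‖x‖ * ‖y‖) ≤ ‖inner 𝕜 x y‖ := by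
    refine div_le_of_le_mul₀ (by positivity) (norm_nonneg _) ?_
    rw [sq]
    exact mul_le_mul_of_nonneg_left (norm_inner_le_norm x y) (norm_nonneg _)
  linarith

theorem norm_rootLift_sub_le (x y : H) :
    ‖rootLift K x - rootLift K y‖ ≤ √2 * natDist b 2 (phaseClass 𝕜 x) (phaseClass 𝕜 y) := by
  refine le_of_sq_le_sq ?_ (mul_nonneg (Real.sqrt_nonneg _) (natDist_nonneg b one_le_two _ _))
  rw [mul_pow, natDist_two_sq, hK.norm_rootLift_sub_sq, Real.sq_sqrt zero_le_two]
  have hle := norm_inner_le_norm (𝕜 := 𝕜) x y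
  have hab : 2 * ‖inner 𝕜 x y‖ ≤ ‖x‖ * ‖y‖ + ‖inner 𝕜 x y‖ ^ 2 / (‖x‖ * ‖y‖) := by
    rcases (mul_nonneg (norm_nonneg x) (norm_nonneg y)).eq_or_lt with h | h
    · rw [← h] at hle ⊢
      rw [div_zero, zero_add]
      linarith
    · have : ‖x‖ * ‖y‖ + ‖inner 𝕜 x y‖ ^ 2 / (‖x‖ * ‖y‖) - 2 * ‖inner 𝕜 x y‖ =
          (‖x‖ * ‖y‖ - ‖inner 𝕜 x y‖) ^ 2 / (‖x‖ * ‖y‖) := by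
        rw [eq_div_iff h.ne', sub_mul, add_mul, div_mul_cancel₀ _ h.ne']
        ring
      have h2 : 0 ≤ (‖x‖ * ‖y‖ - ‖inner 𝕜 x y‖) ^ 2 / (‖x‖ * ‖y‖) := by positivity
      linarith
  nlinarith [sq_nonneg (‖x‖ - ‖y‖)]

theorem matDist_two_eq [FiniteDimensional 𝕜 H] (x y : H) :
    matDist 2 (phaseClass 𝕜 x) (phaseClass 𝕜 y) = ‖K x - K y‖ := by
  rw [← pow_left_inj₀ (matDist_nonneg one_le_two _ _) (norm_nonneg _) two_ne_zero, matDist_two_sq,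
    hK.norm_sub_sq]

end RootLift

/-! ### Positivity of the lower Lipschitz bounds -/

section LowerBounds

variable {𝕜 H : Type*} [RCLike 𝕜] [NormedAddCommGroup H] [InnerProductSpace 𝕜 H]
  {m n : ℕ} {f : Fin m → H}

theorem IsPhaseRetrievableFrame.eq_of_forall_norm_inner_eq (hf : IsPhaseRetrievableFrame 𝕜 f)
    {x y : H} (h : ∀ k, ‖inner 𝕜 (f k) x‖ = ‖inner 𝕜 (f k) y‖) :
    phaseClass 𝕜 x = phaseClass 𝕜 y :=
  hf.injective_alpha (funext h)

/-- The lift separates the points of `Ĥ`, as it determines the measurements. -/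
theorem IsPhaseRetrievableFrame.phaseClass_eq_of_lift_eq {E : Type*} [NormedAddCommGroup E]
    [InnerProductSpace ℝ E] {K : H → E} (hf : IsPhaseRetrievableFrame 𝕜 f)
    (hK : IsFrobeniusLift 𝕜 K) {x y : H} (h : K x = K y) : phaseClass 𝕜 x = phaseClass 𝕜 y := by
  refine hf.eq_of_forall_norm_inner_eq fun k => ?_
  rw [← pow_left_inj₀ (norm_nonneg _) (norm_nonneg _) two_ne_zero, ← hK.inner_eq, ← hK.inner_eq, h]

/-- Polarisation of the intensity measurements. -/
theorem norm_inner_sq_sub_norm_inner_sq (g x y : H) :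
    ‖inner 𝕜 g x‖ ^ 2 - ‖inner 𝕜 g y‖ ^ 2 =
      RCLike.re (inner 𝕜 (x + y) g * inner 𝕜 g (x - y)) := by
  have h : RCLike.re (inner 𝕜 x g * inner 𝕜 g y) = RCLike.re (inner 𝕜 y g * inner 𝕜 g x) := by
    rw [← RCLike.conj_re, RingHom.map_mul, inner_conj_symm, inner_conj_symm, mul_comm]
  have hx : ∀ z, RCLike.re (inner 𝕜 z g * inner 𝕜 g z) = ‖inner 𝕜 g z‖ ^ 2 := by
    intro z
    rw [← inner_conj_symm z g, RCLike.conj_mul, ← RCLike.ofReal_pow, RCLike.ofReal_re]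
  simp only [inner_add_left, inner_sub_right, add_mul, mul_sub, map_add, map_sub, h, hx]
  ring

/-- The quantitative form of injectivity. With `z = x + y` and `w = x - y` the differences of the
intensities are the numbers `re (⟨z, f k⟩ ⟨f k, w⟩)`, and these are not all zero unless `x` and `y`
are equivalent; compactness of the set of unit vectors does the rest. -/
theorem IsPhaseRetrievableFrame.exists_le_sum_re_sq [FiniteDimensional 𝕜 H]
    (hf : IsPhaseRetrievableFrame 𝕜 f) :
    ∃ c : ℝ, 0 < c ∧ ∀ z w : H, RCLike.im (inner 𝕜 z w) = 0 →
      c * (‖z‖ ^ 2 * ‖w‖ ^ 2) ≤ ∑ k, RCLike.re (inner 𝕜 z (f k) * inner 𝕜 (f k) w) ^ 2 := by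
  have : ProperSpace H := FiniteDimensional.proper 𝕜 H
  let S : Set (H × H) := (Metric.sphere 0 1 ×ˢ Metric.sphere 0 1) ∩
    {p | RCLike.im (inner 𝕜 p.1 p.2) = 0}
  let Φ : H × H → ℝ := fun p => ∑ k, RCLike.re (inner 𝕜 p.1 (f k) * inner 𝕜 (f k) p.2) ^ 2
  have hS : IsCompact S := ((isCompact_sphere 0 1).prod (isCompact_sphere 0 1)).inter_right
    (isClosed_eq (by fun_prop) continuous_const)
  have hΦ : Continuous Φ := by fun_prop
  have hpos : ∀ p ∈ S, 0 < Φ p := by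
    rintro ⟨z, w⟩ ⟨⟨hz, hw⟩, him⟩
    rw [mem_sphere_zero_iff_norm] at hz hw
    dsimp only at hz hw
    change RCLike.im (inner 𝕜 z w) = 0 at him
    refine lt_of_le_of_ne (Finset.sum_nonneg fun k _ => sq_nonneg _) fun h0 => ?_
    have hk := (Finset.sum_eq_zero_iff_of_nonneg fun k _ => sq_nonneg _).1 h0.symm
    have heq : phaseClass 𝕜 (z + w) = phaseClass 𝕜 (z - w) := by
      refine hf.eq_of_forall_norm_inner_eq fun k => ?_
      rw [← pow_left_inj₀ (norm_nonneg _) (norm_nonneg _) two_ne_zero, ← sub_eq_zero,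
        norm_inner_sq_sub_norm_inner_sq]
      have h1 : z + w + (z - w) = (2 : 𝕜) • z := by rw [two_smul]; abel
      have h2 : z + w - (z - w) = (2 : 𝕜) • w := by rw [two_smul]; abel
      have h3 := pow_eq_zero_iff two_ne_zero |>.1 (hk k (Finset.mem_univ k))
      rw [h1, h2, inner_smul_left, inner_smul_right, RCLike.conj_ofNat,
        show (2 : 𝕜) * inner 𝕜 z (f k) * (2 * inner 𝕜 (f k) w) =
          ((4 : ℝ) : 𝕜) * (inner 𝕜 z (f k) * inner 𝕜 (f k) w) by push_cast; ring,
        RCLike.re_ofReal_mul, h3, mul_zero]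
    -- As `z` and `w` have the same norm and a real inner product, `z + w` and `z - w` are
    -- orthogonal; being equivalent, they both vanish.
    obtain ⟨a, ha, h⟩ := phaseClass_eq_iff.1 heq
    have horth : inner 𝕜 (z + w) (z - w) = 0 := by
      have hreal : inner 𝕜 w z = inner 𝕜 z w := by
        rw [← inner_conj_symm, RCLike.conj_eq_iff_im.2 him]
      rw [inner_add_left, inner_sub_right, inner_sub_right, inner_self_eq_norm_sq_to_K,
        inner_self_eq_norm_sq_to_K, hz, hw, hreal]
      ring
    have hzero : z + w = 0 := by
      rw [h, inner_smul_right] at horth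
      rcases mul_eq_zero.1 horth with h0 | h0
      · simp [h0] at ha
      · exact inner_self_eq_zero.1 h0
    have hz0 : (2 : 𝕜) • z = 0 := by
      rw [hzero, smul_zero] at h
      rw [two_smul, show z + z = (z + w) + (z - w) by abel, hzero, h, add_zero]
    rcases smul_eq_zero.1 hz0 with h0 | h0
    · exact two_ne_zero h0
    · simp [h0] at hz
  obtain ⟨c, hc, hcS⟩ : ∃ c : ℝ, 0 < c ∧ ∀ p ∈ S, c ≤ Φ p := by
    rcases S.eq_empty_or_nonempty with h | h
    · exact ⟨1, one_pos, by simp [h]⟩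
    · obtain ⟨p, hp, hmin⟩ := hS.exists_isMinOn h hΦ.continuousOn
      exact ⟨Φ p, hpos p hp, fun q hq => hmin hq⟩
  refine ⟨c, hc, fun z w him => ?_⟩
  rcases eq_or_ne z 0 with rfl | hz
  · simp
  rcases eq_or_ne w 0 with rfl | hw
  · simp
  have hz' := norm_ne_zero_iff.2 hz
  have hw' := norm_ne_zero_iff.2 hw
  have hmem : (((‖z‖⁻¹ : ℝ) : 𝕜) • z, ((‖w‖⁻¹ : ℝ) : 𝕜) • w) ∈ S := by
    refine ⟨⟨?_, ?_⟩, ?_⟩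
    · rw [mem_sphere_zero_iff_norm, norm_smul, RCLike.norm_ofReal, abs_inv, abs_norm,
        inv_mul_cancel₀ hz']
    · rw [mem_sphere_zero_iff_norm, norm_smul, RCLike.norm_ofReal, abs_inv, abs_norm,
        inv_mul_cancel₀ hw']
    · change RCLike.im (inner 𝕜 _ _) = 0
      rw [inner_smul_left, inner_smul_right, RCLike.conj_ofReal, RCLike.im_ofReal_mul,
        RCLike.im_ofReal_mul, him, mul_zero, mul_zero]
  have h := hcS _ hmem
  have hΦz : Φ (((‖z‖⁻¹ : ℝ) : 𝕜) • z, ((‖w‖⁻¹ : ℝ) : 𝕜) • w) * (‖z‖ ^ 2 * ‖w‖ ^ 2) =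
      Φ (z, w) := by
    simp only [Φ, Finset.sum_mul]
    refine Finset.sum_congr rfl fun k _ => ?_
    rw [inner_smul_left, inner_smul_right, RCLike.conj_ofReal,
      show ((‖z‖⁻¹ : ℝ) : 𝕜) * inner 𝕜 z (f k) * (((‖w‖⁻¹ : ℝ) : 𝕜) * inner 𝕜 (f k) w) =
        ((‖z‖⁻¹ * ‖w‖⁻¹ : ℝ) : 𝕜) * (inner 𝕜 z (f k) * inner 𝕜 (f k) w) by push_cast; ring,
      RCLike.re_ofReal_mul]
    field_simp
  calc c * (‖z‖ ^ 2 * ‖w‖ ^ 2) ≤ _ := mul_le_mul_of_nonneg_right h (by positivity)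
    _ = _ := hΦz

theorem IsPhaseRetrievableFrame.exists_le_beta_sub_sq [FiniteDimensional 𝕜 H]
    (hf : IsPhaseRetrievableFrame 𝕜 f) :
    ∃ c : ℝ, 0 < c ∧ ∀ x y : H, inner 𝕜 x y = (‖inner 𝕜 x y‖ : 𝕜) →
      c * (‖x + y‖ ^ 2 * ‖x - y‖ ^ 2) ≤
        lpNorm 2 (beta f (phaseClass 𝕜 x) - beta f (phaseClass 𝕜 y)) ^ 2 := by
  obtain ⟨c, hc, h⟩ := hf.exists_le_sum_re_sq
  refine ⟨c, hc, fun x y hxy => ?_⟩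
  have him : RCLike.im (inner 𝕜 (x + y) (x - y)) = 0 := by
    have hyx : inner 𝕜 y x = inner 𝕜 x y := by
      rw [← inner_conj_symm, hxy, RCLike.conj_ofReal]
    rw [inner_add_left, inner_sub_right, inner_sub_right, inner_self_eq_norm_sq_to_K,
      inner_self_eq_norm_sq_to_K, hyx, sub_add_sub_cancel, ← RCLike.ofReal_pow,
      ← RCLike.ofReal_pow, ← RCLike.ofReal_sub, RCLike.ofReal_im]
  refine (h _ _ him).trans_eq ?_
  rw [lpNorm_two_sq]
  refine Finset.sum_congr rfl fun k _ => ?_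
  rw [Pi.sub_apply, beta_phaseClass, beta_phaseClass, norm_inner_sq_sub_norm_inner_sq,
    Real.norm_eq_abs, sq_abs]

theorem IsPhaseRetrievableFrame.exists_mul_matDist_sq_le [FiniteDimensional 𝕜 H]
    (hf : IsPhaseRetrievableFrame 𝕜 f) :
    ∃ c : ℝ, 0 < c ∧ ∀ X Y : PhaseQuotient 𝕜 H,
      c * matDist 1 X Y ^ 2 ≤ lpNorm 2 (beta f X - beta f Y) ^ 2 := by
  obtain ⟨c, hc, h⟩ := hf.exists_le_beta_sub_sq
  refine ⟨c / 2, half_pos hc, fun X Y => ?_⟩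
  obtain ⟨x, y, rfl, rfl, hxy⟩ := exists_aligned X Y
  refine le_trans ?_ (h x y hxy)
  have h1 := matDist_le_two_rpow_mul le_rfl one_le_two (phaseClass 𝕜 x) (phaseClass 𝕜 y)
  have h2 := pow_le_pow_left₀ (matDist_nonneg le_rfl _ _) h1 2
  have hexp : ((2 : ℝ) ^ (1 / (1 : ℝ≥0∞).toReal - 1 / (2 : ℝ≥0∞).toReal)) ^ 2 = 2 := by
    rw [← Real.rpow_mul_natCast zero_le_two]
    norm_num
  rw [mul_pow, matDist_two_sq, hexp] at h2
  have h3 : RCLike.re (inner 𝕜 x y) = ‖inner 𝕜 x y‖ := by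
    conv_lhs => rw [hxy]
    simp
  have hle := norm_inner_le_norm (𝕜 := 𝕜) x y
  have h4 := pow_le_pow_left₀ (norm_nonneg _) hle 2
  rw [norm_add_sq (𝕜 := 𝕜), norm_sub_sq (𝕜 := 𝕜), h3]
  rw [mul_pow] at h4
  have : matDist 1 (phaseClass 𝕜 x) (phaseClass 𝕜 y) ^ 2 ≤
      2 * ((‖x‖ ^ 2 + 2 * ‖inner 𝕜 x y‖ + ‖y‖ ^ 2) * (‖x‖ ^ 2 - 2 * ‖inner 𝕜 x y‖ + ‖y‖ ^ 2)) := by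
    nlinarith
  nlinarith

/-- For representatives with nonnegative inner product, `x + y` is at least as long as the
hypotenuse of `‖x‖` and `‖y‖`, so passing from intensities to magnitudes costs a bounded factor. -/
theorem IsPhaseRetrievableFrame.exists_mul_natDist_sq_le [FiniteDimensional 𝕜 H]
    (hf : IsPhaseRetrievableFrame 𝕜 f) (b : OrthonormalBasis (Fin n) 𝕜 H) :
    ∃ c : ℝ, 0 < c ∧ ∀ X Y : PhaseQuotient 𝕜 H,
      c * natDist b 2 X Y ^ 2 ≤ lpNorm 2 (alpha f X - alpha f Y) ^ 2 := by
  obtain ⟨c, hc, h⟩ := hf.exists_le_beta_sub_sq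
  let M : ℝ := ∑ k, ‖f k‖ ^ 2 + 1
  have hM : 0 < M := by positivity
  refine ⟨c / (2 * M), by positivity, fun X Y => ?_⟩
  obtain ⟨x, y, rfl, rfl, hxy⟩ := exists_aligned X Y
  have h3 : RCLike.re (inner 𝕜 x y) = ‖inner 𝕜 x y‖ := by
    conv_lhs => rw [hxy]
    simp
  have hsum : (‖x‖ + ‖y‖) ^ 2 ≤ 2 * ‖x + y‖ ^ 2 := by
    rw [norm_add_sq (𝕜 := 𝕜), h3]
    nlinarith [sq_nonneg (‖x‖ - ‖y‖), norm_nonneg (inner 𝕜 x y)]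
  have hba : lpNorm 2 (beta f (phaseClass 𝕜 x) - beta f (phaseClass 𝕜 y)) ^ 2 ≤
      M * (‖x‖ + ‖y‖) ^ 2 *
        lpNorm 2 (alpha f (phaseClass 𝕜 x) - alpha f (phaseClass 𝕜 y)) ^ 2 := by
    rw [lpNorm_two_sq, lpNorm_two_sq, Finset.mul_sum]
    refine Finset.sum_le_sum fun k _ => ?_
    have hk : ‖f k‖ ^ 2 ≤ M :=
      (Finset.single_le_sum (f := fun k => ‖f k‖ ^ 2) (fun k _ => by positivity)
        (Finset.mem_univ k)).trans (by simp [M])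
    rw [Pi.sub_apply, Pi.sub_apply, beta_phaseClass, beta_phaseClass, alpha_phaseClass,
      alpha_phaseClass, sq_sub_sq, norm_mul, mul_pow, Real.norm_eq_abs, sq_abs]
    refine mul_le_mul_of_nonneg_right ?_ (by positivity)
    have h5 : ‖inner 𝕜 (f k) x‖ + ‖inner 𝕜 (f k) y‖ ≤ ‖f k‖ * (‖x‖ + ‖y‖) := by
      rw [mul_add]
      exact add_le_add (norm_inner_le_norm _ _) (norm_inner_le_norm _ _)
    have h6 := pow_le_pow_left₀ (by positivity) h5 2
    rw [mul_pow] at h6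
    exact h6.trans (mul_le_mul_of_nonneg_right hk (by positivity))
  rw [natDist_two_aligned b hxy]
  rcases (sq_nonneg (‖x‖ + ‖y‖)).eq_or_lt with h0 | h0
  · have hs : ‖x‖ + ‖y‖ = 0 := by simpa using h0.symm
    have hx : ‖x‖ = 0 := by linarith [norm_nonneg x, norm_nonneg y]
    have hy : ‖y‖ = 0 := by linarith [norm_nonneg x, norm_nonneg y]
    rw [norm_eq_zero.1 hx, norm_eq_zero.1 hy]
    rw [sub_self, norm_zero, zero_pow two_ne_zero, mul_zero]
    exact sq_nonneg _
  · refine le_of_mul_le_mul_left ?_ (mul_pos hM h0)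
    refine le_trans ?_ hba
    refine le_trans ?_ (h x y hxy)
    calc M * (‖x‖ + ‖y‖) ^ 2 * (c / (2 * M) * ‖x - y‖ ^ 2)
        = c * ((‖x‖ + ‖y‖) ^ 2 / 2 * ‖x - y‖ ^ 2) := by field_simp
      _ ≤ _ := by
        gcongr
        linarith

/-- Distinct classes exist as soon as the space is nonzero. -/
theorem exists_phaseClass_ne [Nontrivial H] : ∃ X Y : PhaseQuotient 𝕜 H, X ≠ Y := by
  obtain ⟨x, hx⟩ := exists_ne (0 : H)
  refine ⟨phaseClass 𝕜 0, phaseClass 𝕜 x, fun h => hx ?_⟩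
  obtain ⟨a, -, rfl⟩ := phaseClass_eq_iff.1 h
  exact smul_zero a

/-- The infimum of the quotients `N² / D²` is positive if `N² ≥ c D²` and `D` vanishes only on
the diagonal. -/
theorem sInf_ratio_pos {α : Type*} {N D : α → α → ℝ} {c : ℝ} (hc : 0 < c)
    (hD : ∀ X Y, D X Y = 0 → X = Y) (h : ∀ X Y, c * D X Y ^ 2 ≤ N X Y ^ 2)
    (hne : ∃ X Y : α, X ≠ Y) : 0 < sInf {r : ℝ | ∃ X Y, X ≠ Y ∧ r = N X Y ^ 2 / D X Y ^ 2} := by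
  obtain ⟨X, Y, hXY⟩ := hne
  refine hc.trans_le (le_csInf ⟨_, X, Y, hXY, rfl⟩ ?_)
  rintro _ ⟨X, Y, hXY, rfl⟩
  rw [le_div_iff₀ (sq_pos_of_ne_zero (mt (hD X Y) hXY))]
  exact h X Y

/-- The square root of the infimum of `N² / D²` is a lower Lipschitz bound. -/
theorem le_one_div_sqrt_sInf_ratio_mul {α : Type*} {N D : α → α → ℝ} (hN : ∀ X Y, 0 ≤ N X Y)
    (hD : ∀ X, D X X = 0)
    (hpos : (∃ X Y : α, X ≠ Y) → 0 < sInf {r : ℝ | ∃ X Y, X ≠ Y ∧ r = N X Y ^ 2 / D X Y ^ 2})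
    (X Y : α) :
    D X Y ≤ 1 / √(sInf {r : ℝ | ∃ X Y, X ≠ Y ∧ r = N X Y ^ 2 / D X Y ^ 2}) * N X Y := by
  rcases eq_or_ne X Y with rfl | hXY
  · rw [hD]
    exact mul_nonneg (by positivity) (hN _ _)
  have hp := hpos ⟨X, Y, hXY⟩
  have hle : sInf {r : ℝ | ∃ X Y, X ≠ Y ∧ r = N X Y ^ 2 / D X Y ^ 2} ≤ N X Y ^ 2 / D X Y ^ 2 :=
    csInf_le ⟨0, by rintro _ ⟨X, Y, -, rfl⟩; positivity⟩ ⟨X, Y, hXY, rfl⟩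
  generalize sInf {r : ℝ | ∃ X Y, X ≠ Y ∧ r = N X Y ^ 2 / D X Y ^ 2} = s at hp hle ⊢
  have hD0 : 0 < D X Y ^ 2 := by
    refine lt_of_le_of_ne (sq_nonneg _) fun h0 => ?_
    rw [← h0, div_zero] at hle
    linarith
  rw [le_div_iff₀ hD0] at hle
  rw [one_div, ← div_eq_inv_mul, le_div_iff₀ (Real.sqrt_pos.2 hp)]
  refine le_of_sq_le_sq ?_ (hN _ _)
  rw [mul_pow, Real.sq_sqrt hp.le]
  linarith

theorem natDist_self (b : OrthonormalBasis (Fin n) 𝕜 H) (X : PhaseQuotient 𝕜 H) :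
    natDist b 2 X X = 0 := by
  obtain ⟨x, rfl⟩ := exists_phaseClass X
  rw [← sq_eq_zero_iff, natDist_two_sq, inner_self_eq_norm_sq_to_K, norm_pow, RCLike.norm_ofReal,
    abs_norm]
  ring

variable [FiniteDimensional 𝕜 H] (b : OrthonormalBasis (Fin n) 𝕜 H)

theorem matDist_self (X : PhaseQuotient 𝕜 H) : matDist 1 X X = 0 := by
  obtain ⟨x, rfl⟩ := exists_phaseClass X
  have h := matDist_le_two_rpow_mul le_rfl one_le_two (phaseClass 𝕜 x) (phaseClass 𝕜 x)
  have h2 : matDist 2 (phaseClass 𝕜 x) (phaseClass 𝕜 x) = 0 := by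
    rw [← sq_eq_zero_iff, matDist_two_sq, inner_self_eq_norm_sq_to_K, norm_pow,
      RCLike.norm_ofReal, abs_norm]
    ring
  rw [h2, mul_zero] at h
  exact le_antisymm h (matDist_nonneg le_rfl _ _)

theorem IsPhaseRetrievableFrame.lowerBoundAlpha_pos (hf : IsPhaseRetrievableFrame 𝕜 f)
    (hne : ∃ X Y : PhaseQuotient 𝕜 H, X ≠ Y) : 0 < lowerBoundAlpha b f := by
  obtain ⟨c, hc, h⟩ := hf.exists_mul_natDist_sq_le b
  refine sInf_ratio_pos (N := fun X Y => lpNorm 2 (alpha f X - alpha f Y)) hc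
    (fun X Y h0 => ?_) h hne
  obtain ⟨F, _, _, _, K, hK⟩ := exists_isFrobeniusLift b
  obtain ⟨x, rfl⟩ := exists_phaseClass X
  obtain ⟨y, rfl⟩ := exists_phaseClass Y
  have := norm_rootLift_sub_le b hK x y
  rw [h0, mul_zero, norm_le_zero_iff, sub_eq_zero] at this
  exact hf.phaseClass_eq_of_lift_eq hK (hK.eq_of_rootLift_eq this)

theorem IsPhaseRetrievableFrame.lowerBoundBeta_pos (hf : IsPhaseRetrievableFrame 𝕜 f)
    (hne : ∃ X Y : PhaseQuotient 𝕜 H, X ≠ Y) : 0 < lowerBoundBeta 𝕜 f := by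
  obtain ⟨c, hc, h⟩ := hf.exists_mul_matDist_sq_le
  refine sInf_ratio_pos (N := fun X Y => lpNorm 2 (beta f X - beta f Y)) hc
    (fun X Y h0 => ?_) h hne
  obtain ⟨F, _, _, _, K, hK⟩ := exists_isFrobeniusLift (stdOrthonormalBasis 𝕜 H)
  obtain ⟨x, rfl⟩ := exists_phaseClass X
  obtain ⟨y, rfl⟩ := exists_phaseClass Y
  have := matDist_antitone le_rfl one_le_two (phaseClass 𝕜 x) (phaseClass 𝕜 y)
  rw [h0, matDist_two_eq hK, norm_le_zero_iff, sub_eq_zero] at this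
  exact hf.phaseClass_eq_of_lift_eq hK this

theorem IsPhaseRetrievableFrame.natDist_le_mul_alpha (hf : IsPhaseRetrievableFrame 𝕜 f)
    (X Y : PhaseQuotient 𝕜 H) :
    natDist b 2 X Y ≤ 1 / √(lowerBoundAlpha b f) * lpNorm 2 (alpha f X - alpha f Y) :=
  le_one_div_sqrt_sInf_ratio_mul (N := fun X Y => lpNorm 2 (alpha f X - alpha f Y))
    (fun _ _ => lpNorm_nonneg one_le_two _) (natDist_self b) (hf.lowerBoundAlpha_pos b) X Y

theorem IsPhaseRetrievableFrame.matDist_le_mul_beta (hf : IsPhaseRetrievableFrame 𝕜 f)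
    (X Y : PhaseQuotient 𝕜 H) :
    matDist 1 X Y ≤ 1 / √(lowerBoundBeta 𝕜 f) * lpNorm 2 (beta f X - beta f Y) :=
  le_one_div_sqrt_sInf_ratio_mul (N := fun X Y => lpNorm 2 (beta f X - beta f Y))
    (fun _ _ => lpNorm_nonneg one_le_two _) matDist_self hf.lowerBoundBeta_pos X Y

end LowerBounds

/-! ### The Lipschitz left inverses -/

section Reconstruction

variable {𝕜 H : Type*} [RCLike 𝕜] [NormedAddCommGroup H] [InnerProductSpace 𝕜 H]
  [FiniteDimensional 𝕜 H] {m n : ℕ} {f : Fin m → H}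

/-- Extension of a Lipschitz map from a subset of `ℓ²` to the cone of matrices `xx^*`. -/
theorem exists_extension_to_cone {E : Type*} [NormedAddCommGroup E] [InnerProductSpace ℝ E]
    [FiniteDimensional ℝ E] {K : H → E} (hK : IsFrobeniusLift 𝕜 K) {ι : Type*}
    (g : ι → Fin m → ℝ) (k : ι → E) (hk : ∀ i, ∃ x, k i = K x) {L : ℝ} (hL : 0 ≤ L)
    (h : ∀ i j, ‖k i - k j‖ ≤ L * lpNorm 2 (g i - g j)) :
    ∃ G : (Fin m → ℝ) → E, (∀ i, G (g i) = k i) ∧ (∀ c, ∃ x, G c = K x) ∧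
      ∀ c d, ‖G c - G d‖ ≤ √5 * L * lpNorm 2 (c - d) := by
  obtain ⟨F, hF, hFL⟩ := exists_lipschitz_extension hL
    (fun i => (WithLp.toLp 2 (g i) : EuclideanSpace ℝ (Fin m))) k h
  obtain ⟨π, hπ, hπK, hπL⟩ := exists_retraction hK
  refine ⟨fun c => π (F (WithLp.toLp 2 c)), fun i => ?_, fun c => hπ _, fun c d => ?_⟩
  · obtain ⟨x, hx⟩ := hk i
    dsimp only
    rw [hF, hx, hπK]
  · refine (hπL _ _).trans ?_
    rw [mul_assoc]
    exact mul_le_mul_of_nonneg_left (hFL _ _) (Real.sqrt_nonneg _)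

theorem IsPhaseRetrievableFrame.exists_left_inverse_alpha (hf : IsPhaseRetrievableFrame 𝕜 f)
    (b : OrthonormalBasis (Fin n) 𝕜 H) :
    ∃ ω : (Fin m → ℝ) → PhaseQuotient 𝕜 H, (∀ X, ω (alpha f X) = X) ∧
      ∀ c d, natDist b 2 (ω c) (ω d) ≤ √5 * √2 / √(lowerBoundAlpha b f) * lpNorm 2 (c - d) := by
  obtain ⟨E, _, _, _, K, hK⟩ := exists_isFrobeniusLift b
  obtain ⟨G, hG, hGK, hGL⟩ := exists_extension_to_cone hK
    (fun x : H => alpha f (phaseClass 𝕜 x)) (rootLift K)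
    (fun x => (hK.exists_eq_rootLift x).imp fun _ => Eq.symm)
    (L := √2 / √(lowerBoundAlpha b f)) (by positivity) (fun x y => by
      refine (norm_rootLift_sub_le b hK x y).trans ?_
      rw [div_eq_mul_one_div, mul_assoc]
      exact mul_le_mul_of_nonneg_left (hf.natDist_le_mul_alpha b _ _) (Real.sqrt_nonneg _))
  have hz : ∀ c, ∃ z, rootLift K z = G c := fun c => by
    obtain ⟨x, hx⟩ := hGK c
    exact hx ▸ hK.exists_rootLift_eq x
  choose z hz using hz
  refine ⟨fun c => phaseClass 𝕜 (z c), fun X => ?_, fun c d => ?_⟩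
  · obtain ⟨x, rfl⟩ := exists_phaseClass X
    exact hf.phaseClass_eq_of_lift_eq hK (hK.eq_of_rootLift_eq ((hz _).trans (hG x)))
  · refine (natDist_two_le_norm_rootLift_sub b hK _ _).trans ?_
    rw [hz, hz, mul_div_assoc]
    exact hGL c d

theorem IsPhaseRetrievableFrame.exists_left_inverse_beta (hf : IsPhaseRetrievableFrame 𝕜 f) :
    ∃ ψ : (Fin m → ℝ) → PhaseQuotient 𝕜 H, (∀ X, ψ (beta f X) = X) ∧
      ∀ c d, matDist 2 (ψ c) (ψ d) ≤ √5 / √(lowerBoundBeta 𝕜 f) * lpNorm 2 (c - d) := by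
  obtain ⟨E, _, _, _, K, hK⟩ := exists_isFrobeniusLift (stdOrthonormalBasis 𝕜 H)
  obtain ⟨G, hG, hGK, hGL⟩ := exists_extension_to_cone hK
    (fun x : H => beta f (phaseClass 𝕜 x)) K (fun x => ⟨x, rfl⟩)
    (L := 1 / √(lowerBoundBeta 𝕜 f)) (by positivity) (fun x y => by
      rw [← matDist_two_eq hK]
      exact (matDist_antitone le_rfl one_le_two _ _).trans (hf.matDist_le_mul_beta _ _))
  choose z hz using hGK
  refine ⟨fun c => phaseClass 𝕜 (z c), fun X => ?_, fun c d => ?_⟩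
  · obtain ⟨x, rfl⟩ := exists_phaseClass X
    exact hf.phaseClass_eq_of_lift_eq hK ((hz _).symm.trans (hG x))
  · rw [matDist_two_eq hK, ← hz, ← hz, div_eq_mul_one_div]
    exact hGL c d

/-- Combination of an `ℓ²` Lipschitz bound for one metric with the comparison of `ℓ^p` norms in
the domain and of two metrics in the target. -/
theorem le_mul_lpNorm_of_le {D D₂ s s' A N : ℝ} {p : ℝ≥0∞} (hp : 1 ≤ p) {c : Fin m → ℝ}
    (h2 : D₂ ≤ s / √A * lpNorm 2 c) (hN : 0 ≤ N) (hD : D ≤ N * D₂) (hs : 0 ≤ s) (hss : s ≤ s') :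
    D ≤ s' / √A * N * max 1 ((m : ℝ) ^ (1 / 2 - 1 / p.toReal)) * lpNorm p c := by
  have hc := lpNorm_nonneg hp c
  calc D ≤ N * (s / √A * lpNorm 2 c) := hD.trans (mul_le_mul_of_nonneg_left h2 hN)
    _ ≤ N * (s' / √A *
          (max 1 ((m : ℝ) ^ (1 / 2 - 1 / p.toReal)) * lpNorm p c)) := by
        have := lpNorm_two_le hp c
        have := lpNorm_nonneg one_le_two c
        gcongr
        exact div_nonneg (hs.trans hss) (Real.sqrt_nonneg _)
    _ = _ := by ring

end Reconstruction

end PhaseRetrieval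

theorem theorem3p2 {𝕜 H : Type*} [RCLike 𝕜] [NormedAddCommGroup H] [InnerProductSpace 𝕜 H]
    [FiniteDimensional 𝕜 H] {m n : ℕ} (b : OrthonormalBasis (Fin n) 𝕜 H) (f : Fin m → H)
    (hf : PhaseRetrieval.IsPhaseRetrievableFrame 𝕜 f) :
    (0 < n → 0 < PhaseRetrieval.lowerBoundAlpha b f ∧ 0 < PhaseRetrieval.lowerBoundBeta 𝕜 f) ∧
    (∃ ω : (Fin m → ℝ) → PhaseRetrieval.PhaseQuotient 𝕜 H,
      (∀ x, ω (PhaseRetrieval.alpha f x) = x) ∧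
      (∀ p q : ℝ≥0∞, 1 ≤ p → 1 ≤ q →
        (q ≤ 2 → ∀ c d : Fin m → ℝ,
          PhaseRetrieval.natDist b q (ω c) (ω d) ≤
            (3 * √2 + 4) / √(PhaseRetrieval.lowerBoundAlpha b f)
              * (n : ℝ) ^ (1 / q.toReal - 1 / 2) * max 1 ((m : ℝ) ^ (1 / 2 - 1 / p.toReal))
              * PhaseRetrieval.lpNorm p (c - d)) ∧
        (2 < q → ∀ c d : Fin m → ℝ,
          PhaseRetrieval.natDist b q (ω c) (ω d) ≤
            (3 * √2 + (2 : ℝ) ^ (3 / 2 + 1 / q.toReal)) / √(PhaseRetrieval.lowerBoundAlpha b f)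
              * (n : ℝ) ^ (1 / 2 - 1 / q.toReal) * max 1 ((m : ℝ) ^ (1 / 2 - 1 / p.toReal))
              * PhaseRetrieval.lpNorm p (c - d))) ∧
      (∀ c d : Fin m → ℝ,
        PhaseRetrieval.natDist b 2 (ω c) (ω d) ≤
          (4 + 3 * √2) / √(PhaseRetrieval.lowerBoundAlpha b f)
            * PhaseRetrieval.lpNorm 2 (c - d))) ∧
    (∃ ψ : (Fin m → ℝ) → PhaseRetrieval.PhaseQuotient 𝕜 H,
      (∀ x, ψ (PhaseRetrieval.beta f x) = x) ∧
      (∀ p q : ℝ≥0∞, 1 ≤ p → 1 ≤ q →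
        (q ≤ 2 → ∀ c d : Fin m → ℝ,
          PhaseRetrieval.matDist q (ψ c) (ψ d) ≤
            (3 + 2 * √2) / √(PhaseRetrieval.lowerBoundBeta 𝕜 f)
              * (2 : ℝ) ^ (1 / q.toReal - 1 / 2) * max 1 ((m : ℝ) ^ (1 / 2 - 1 / p.toReal))
              * PhaseRetrieval.lpNorm p (c - d)) ∧
        (2 < q → ∀ c d : Fin m → ℝ,
          PhaseRetrieval.matDist q (ψ c) (ψ d) ≤
            (3 + (2 : ℝ) ^ (1 + 1 / q.toReal)) / √(PhaseRetrieval.lowerBoundBeta 𝕜 f)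
              * max 1 ((m : ℝ) ^ (1 / 2 - 1 / p.toReal))
              * PhaseRetrieval.lpNorm p (c - d))) ∧
      (∀ c d : Fin m → ℝ,
        PhaseRetrieval.matDist 1 (ψ c) (ψ d) ≤
          (4 + 3 * √2) / √(PhaseRetrieval.lowerBoundBeta 𝕜 f)
            * PhaseRetrieval.lpNorm 2 (c - d))) := by
  have h5 : √5 ≤ 3 := Real.sqrt_le_iff.2 (by norm_num)
  have h2 : 0 ≤ √2 := Real.sqrt_nonneg 2
  have h52 : √5 * √2 ≤ 3 * √2 := mul_le_mul_of_nonneg_right h5 h2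
  have h0 : 0 ≤ √5 * √2 := by positivity
  refine ⟨fun hn => ?_, ?_, ?_⟩
  · have : Nontrivial H := by
      refine Module.nontrivial_of_finrank_pos (R := 𝕜) ?_
      rwa [Module.finrank_eq_card_basis b.toBasis, Fintype.card_fin]
    have hne := PhaseRetrieval.exists_phaseClass_ne (𝕜 := 𝕜) (H := H)
    exact ⟨hf.lowerBoundAlpha_pos b hne, hf.lowerBoundBeta_pos hne⟩
  · obtain ⟨ω, hω, hL⟩ := hf.exists_left_inverse_alpha b
    refine ⟨ω, hω, fun p q hp hq => ⟨fun hq2 c d => ?_, fun hq2 c d => ?_⟩, fun c d => ?_⟩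
    · exact PhaseRetrieval.le_mul_lpNorm_of_le hp (hL c d) (by positivity)
        (PhaseRetrieval.natDist_le_rpow_mul_of_le_two b hq hq2 _ _) h0 (by linarith)
    · have : 0 < (2 : ℝ) ^ (3 / 2 + 1 / q.toReal) := by positivity
      exact PhaseRetrieval.le_mul_lpNorm_of_le hp (hL c d) (by positivity)
        (PhaseRetrieval.natDist_le_rpow_mul_of_two_le b hq2.le _ _) h0 (by linarith)
    · refine (hL c d).trans ?_
      have := PhaseRetrieval.lpNorm_nonneg one_le_two (c - d)
      gcongr
      linarith
  · obtain ⟨ψ, hψ, hL⟩ := hf.exists_left_inverse_beta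
    refine ⟨ψ, hψ, fun p q hp hq => ⟨fun hq2 c d => ?_, fun hq2 c d => ?_⟩, fun c d => ?_⟩
    · exact PhaseRetrieval.le_mul_lpNorm_of_le hp (hL c d) (by positivity)
        (PhaseRetrieval.matDist_le_two_rpow_mul hq hq2 _ _) (Real.sqrt_nonneg 5) (by linarith)
    · have : 0 < (2 : ℝ) ^ (1 + 1 / q.toReal) := by positivity
      have h := PhaseRetrieval.le_mul_lpNorm_of_le (N := 1) hp (hL c d) zero_le_one
        ((PhaseRetrieval.matDist_antitone one_le_two hq2.le _ _).trans_eq (one_mul _).symm)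
        (Real.sqrt_nonneg 5) (show √5 ≤ 3 + (2 : ℝ) ^ (1 + 1 / q.toReal) by linarith)
      rwa [mul_one] at h
    · have hexp : (2 : ℝ) ^ (1 / (1 : ENNReal).toReal - 1 / (2 : ENNReal).toReal) = √2 := by
        rw [Real.sqrt_eq_rpow]
        norm_num
      have h1 := PhaseRetrieval.matDist_le_two_rpow_mul le_rfl one_le_two (ψ c) (ψ d)
      rw [hexp] at h1
      have := PhaseRetrieval.lpNorm_nonneg one_le_two (c - d)
      calc PhaseRetrieval.matDist 1 (ψ c) (ψ d)
          ≤ √2 * (√5 / √(PhaseRetrieval.lowerBoundBeta 𝕜 f)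
              * PhaseRetrieval.lpNorm 2 (c - d)) := h1.trans (mul_le_mul_of_nonneg_left (hL c d) h2)
        _ = (√5 * √2) / √(PhaseRetrieval.lowerBoundBeta 𝕜 f)
              * PhaseRetrieval.lpNorm 2 (c - d) := by ring
        _ ≤ _ := by
          gcongr
          linarith
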